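/- **Setting.** Let $Z,N\sim\mathcal N(0,1)$ be independent. Call $f:\mathbb R\to\mathbb R$ *admissible* if $\mathbb R$ is a finite disjoint union of intervals (possibly single points) on each of which $f$ is continuously differentiable and either strictly monotonic or constant, and $\lfloor f(Z)\rfloor$ has finite entropy. For $v\in(0,1]$ put $$\mathsf{mmse}_z(v)=\mathbb E\Big[\big(Z-\mathbb E[Z\mid \sqrt{v^{-1}-1}\,Z+N,\ f(Z)]\big)^2\Big],\qquad \phi(v)=\Big(\frac1{\mathsf{mmse}_z(v)}-\frac1v\Big)^{-1}\in[0,\infty],$$ $$g(v)=1-\delta\Big(1-\frac{\mathsf{mmse}_z(v)}{v}\Big),\qquad G(v)=\max(g(v),0),$$ with $\phi(0)=\lim_{v\downarrow0}\phi(v)$ and $g(0)=\lim_{v\downarrow0}g(v)$. For $\delta>1$, a *spectrum at ratio $\delta$* is (the law of) a random variable $\lambda$ with values in some compact interval $[a,b]$, $a>0$, and $\mathbb E[\lambda]=\delta$. For such $\lambda$ and $v\in[0,\infty]$ let $$\Phi(v)=\Big(\frac{1}{\frac1\delta\,\mathbb E\big[\frac{v\lambda}{v+\lambda}\big]}-\frac1v\Big)^{-1},\qquad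 \mathsf{MSE}_\lambda(v)=\mathbb E\Big[\frac{v}{v+\lambda}\Big],$$ with the limiting values $\Phi(0)=0$, $\Phi(\infty)=1$, $\mathsf{MSE}_\lambda(0)=0$, $\mathsf{MSE}_\lambda(\infty)=1$. The state evolution of GLM-EP is $V_r^{-1}=1$, $V_l^{t}=\phi(V_r^{t-1})$, $V_r^{t}=\Phi(V_l^{t})$ for $t\ge0$; put $V_\lambda^\star=\lim_{t\to\infty}V_r^t$ and $\mathsf{MSE}^\star_\lambda=\mathsf{MSE}_\lambda(\phi(V^\star_\lambda))$. For a nonnegative random variable with distribution function $F$ let $F^{-1}(y)=\sup\{x:F(x)\le y\}$ and $L(u)=\int_0^uF^{-1}(y)\,dy\big/\int_0^1F^{-1}(y)\,dy$; $\lambda_1$ is *spikier* than $\lambda_2$, written $\lambda_1\succeq_L\lambda_2$, if $L_{\lambda_1}(u)\le L_{\lambda_2}(u)$ for all $u\in[0,1]$. **Statement.** Let $\delta>1$. For every admissible $f$ and all spectra $\lambda_1\succeq_L\lambda_2$ at ratio $\delta$, the limits $V^\star_{\lambda_1}$ and $V^\star_{\lambda_2}$ exist, and 1. if $G$ is (weakly)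 increasing on $[0,1]$, then $\mathsf{MSE}^\star_{\lambda_1}\le\mathsf{MSE}^\star_{\lambda_2}$; 2. if $G$ is (weakly) decreasing on $[0,1]$, then $\mathsf{MSE}^\star_{\lambda_1}\ge\mathsf{MSE}^\star_{\lambda_2}$. 3. If $G$ is not monotonic, the comparison is in general not definite: there is an admissible $f$ for which $G$ is neither increasing nor decreasing on $[0,1]$ and for which there are spectra $\lambda_1\succeq_L\lambda_2$ at ratio $\delta$ with $\mathsf{MSE}^\star_{\lambda_1}<\mathsf{MSE}^\star_{\lambda_2}$, and also spectra $\lambda_1'\succeq_L\lambda_2'$ at ratio $\delta$ with $\mathsf{MSE}^\star_{\lambda_1'}>\mathsf{MSE}^\star_{\lambda_2'}$. -/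

import Mathlib

open MeasureTheory ProbabilityTheory Filter Topology Set
open scoped ENNReal

namespace GLMEP

noncomputable section

/-- The conditional MMSE `mmse(Z, snr | U) = E[(Z - E[Z | √snr Z + N, U])²]`, where the noise
`N ∼ N(0,1)` is independent of `(Z, U)`. It is realised on the product of the space `Ω` on which
`(Z, U)` lives with the line carrying the law of `N`, so `ω.2` is `N`. -/
def condMMSE {Ω S : Type*} [MeasurableSpace Ω] [MeasurableSpace S] (μ : Measure Ω)
    (Z : Ω → ℝ) (U : Ω → S) (snr : ℝ) : ℝ :=
  ∫ ω, (Z ω.1 - ((μ.prod (gaussianReal 0 1))[fun ω : Ω × ℝ => Z ω.1 |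
      MeasurableSpace.comap (fun ω : Ω × ℝ => (√snr * Z ω.1 + ω.2, U ω.1)) inferInstance]) ω) ^ 2
    ∂(μ.prod (gaussianReal 0 1))

/-- `mmse_z(v) = mmse(Z, 1/v - 1 | f(Z))` with `Z ∼ N(0,1)`, for `v ∈ (0,1]`. -/
def mmseZ (f : ℝ → ℝ) (v : ℝ) : ℝ :=
  condMMSE (gaussianReal 0 1) (fun z => z) f (v⁻¹ - 1)

/-- The state evolution map `φ(v) = (1 / mmse_z(v) - 1 / v)⁻¹`, with values in `[0,∞]`:
it is `∞` where `mmse_z(v) = v` and `0` where `mmse_z(v) = 0`. At `v = 0` it is the limit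
from the right. -/
def phi (f : ℝ → ℝ) (v : ℝ) : ℝ≥0∞ :=
  if v = 0 then
    limUnder (𝓝[>] (0 : ℝ))
      (fun w : ℝ => ((ENNReal.ofReal (mmseZ f w))⁻¹ - (ENNReal.ofReal w)⁻¹)⁻¹)
  else ((ENNReal.ofReal (mmseZ f v))⁻¹ - (ENNReal.ofReal v)⁻¹)⁻¹

/-- `E[v λ / (v + λ)]` for `λ ∼ P`, `v ∈ [0,∞]`. The integrand is written as `(1/v + 1/λ)⁻¹`,
which is the same for `0 < v < ∞` and takes the limiting values `0` at `v = 0` and `λ` at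
`v = ∞`. -/
def meanHarm (P : Measure ℝ) (v : ℝ≥0∞) : ℝ≥0∞ :=
  ∫⁻ x, (v⁻¹ + (ENNReal.ofReal x)⁻¹)⁻¹ ∂P

/-- The state evolution map `Φ(v) = (1 / ((1/δ) E[v λ / (v + λ)]) - 1 / v)⁻¹`, `v ∈ [0,∞]`,
with `Φ(0) = 0`. -/
def Phi (δ : ℝ) (P : Measure ℝ) (v : ℝ≥0∞) : ℝ :=
  if v = 0 then 0
  else (((ENNReal.ofReal δ)⁻¹ * meanHarm P v)⁻¹ - v⁻¹)⁻¹.toReal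

/-- The state evolution sequence `V_r`, with the index shifted by one: `seVr 0` is the
initialisation `V_r^{-1} = 1`, and `seVr (t + 1) = V_r^t = Φ(V_l^t)` with
`V_l^t = φ(V_r^{t-1})`. -/
def seVr (f : ℝ → ℝ) (δ : ℝ) (P : Measure ℝ) : ℕ → ℝ
  | 0 => 1
  | t + 1 => Phi δ P (phi f (seVr f δ P t))

/-- The limit `V_λ^⋆` of the state evolution sequence `V_r^t` as `t → ∞`. -/
def Vstar (f : ℝ → ℝ) (δ : ℝ) (P : Measure ℝ) : ℝ :=
  limUnder atTop (seVr f δ P)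

/-- `MSE_λ(v) = E[v / (v + λ)]` for `λ ∼ P`, `v ∈ [0,∞]`. The integrand is written as
`(1 + λ/v)⁻¹`, which for `λ > 0` is `0` at `v = 0` and `1` at `v = ∞`. -/
def mse (P : Measure ℝ) (v : ℝ≥0∞) : ℝ :=
  (∫⁻ x, (1 + ENNReal.ofReal x / v)⁻¹ ∂P).toReal

/-- The final mean square error `MSE_λ^⋆ = MSE_λ(φ(V_λ^⋆))`. -/
def mseStar (f : ℝ → ℝ) (δ : ℝ) (P : Measure ℝ) : ℝ :=
  mse P (phi f (Vstar f δ P))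

/-- `g(v) = 1 - δ (1 - mmse_z(v) / v)`; at `v = 0` it is the limit from the right. -/
def gFun (f : ℝ → ℝ) (δ v : ℝ) : ℝ :=
  if v = 0 then limUnder (𝓝[>] (0 : ℝ)) (fun w : ℝ => 1 - δ * (1 - mmseZ f w / w))
  else 1 - δ * (1 - mmseZ f v / v)

/-- `G(v) = max(g(v), 0)`. -/
def GFun (f : ℝ → ℝ) (δ v : ℝ) : ℝ := max (gFun f δ v) 0

/-- The quantile function `F⁻¹(y) = sup {x : F(x) ≤ y}` of the distribution `P` with
cumulative distribution function `F`. -/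
def quantile (P : Measure ℝ) (y : ℝ) : ℝ := sSup {x : ℝ | cdf P x ≤ y}

/-- The Lorenz curve `L(u) = ∫_0^u F⁻¹ / ∫_0^1 F⁻¹` of the distribution `P`. -/
def lorenzCurve (P : Measure ℝ) (u : ℝ) : ℝ :=
  (∫ y in (0 : ℝ)..u, quantile P y) / (∫ y in (0 : ℝ)..1, quantile P y)

/-- `P₁` is spikier than `P₂` in the Lorenz order. -/
def Spikier (P₁ P₂ : Measure ℝ) : Prop :=
  ∀ u ∈ Icc (0 : ℝ) 1, lorenzCurve P₁ u ≤ lorenzCurve P₂ u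

/-- The admissible limiting eigenvalue distributions at sampling ratio `δ`: probability
measures supported in a compact interval `[a,b]` with `a > 0` and having mean `δ`. -/
structure IsLimitingSpectrum (δ : ℝ) (P : Measure ℝ) : Prop where
  prob : IsProbabilityMeasure P
  support : ∃ a b : ℝ, 0 < a ∧ P (Icc a b)ᶜ = 0
  mean : ∫ x, x ∂P = δ

/-- The admissible nonlinearities: the line is the union of finitely many disjoint intervals
(possibly degenerate) on each of which `f` is continuously differentiable and either strictly
monotonic or constant; and the entropy of `⌊f(Z)⌋`, `Z ∼ N(0,1)`, is finite. -/
structure IsAdmissible (f : ℝ → ℝ) : Prop where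
  pieces : ∃ (K : ℕ) (I : Fin K → Set ℝ),
    (∀ k, (I k).OrdConnected) ∧ Pairwise (fun i j => Disjoint (I i) (I j)) ∧
    (⋃ k, I k) = univ ∧
    ∀ k, ContDiffOn ℝ 1 f (I k) ∧
      (StrictMonoOn f (I k) ∨ StrictAntiOn f (I k) ∨ ∃ c, ∀ x ∈ I k, f x = c)
  entropy : Summable fun k : ℤ =>
    Real.negMulLog ((gaussianReal 0 1).real {z : ℝ | ⌊f z⌋ = k})

end

end GLMEP

/-!
Both state evolution maps are monotone, so the iteration started at `1` decreases to its largest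
fixed point `V⋆`. At a positive fixed point the two equations combine to `MSE⋆ = G(V⋆)`; if `V⋆ = 0`
then `MSE⋆ = 0`. A spikier spectrum has a smaller `Φ`, because `l ↦ l / (1 + x l)` is concave, hence
a smaller `V⋆`, and the monotonicity of `G` decides the comparison. If `G` is antitone and the
smaller `V⋆` vanishes, `MSE⋆ = G(V⋆)` is replaced there by `G ≤ MSE ∘ φ` to the right of `V⋆`.

For the indefinite case take the indicator of a very short interval, which reveals little about `Z`
both as `v → 0` and near `v = 1`, and compare the constant spectrum `δ`, the least spiky one, with
two-point spectra. One for which the iteration stops only near `0` has an error close to `1`,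
whereas one that lowers `V⋆` from near `1` to below `1/2` improves on the constant spectrum.
-/

namespace GLMEP

noncomputable section

local notation "γ" => gaussianReal 0 1
local notation "γ²" => Measure.prod (gaussianReal 0 1) (gaussianReal 0 1)

/-! ### Mean squares and the standard Gaussian law -/

section MeanSq

variable {Ω : Type*}

section

variable [MeasurableSpace Ω] {μ : Measure Ω} {X : Ω → ℝ}

/-- The mean square `E[X²]`, valued in `[0,∞]` so that the error of an arbitrary measurable
estimator makes sense. -/
def meanSq (μ : Measure Ω) (X : Ω → ℝ) : ℝ≥0∞ :=
  ∫⁻ ω, ENNReal.ofReal (X ω ^ 2) ∂μ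

lemma meanSq_eq_ofReal_integral (hX : MemLp X 2 μ) :
    meanSq μ X = ENNReal.ofReal (∫ ω, X ω ^ 2 ∂μ) :=
  (ofReal_integral_eq_lintegral_ofReal hX.integrable_sq (ae_of_all _ fun _ => sq_nonneg _)).symm

lemma meanSq_eq_eLpNorm_sq (μ : Measure Ω) (X : Ω → ℝ) : meanSq μ X = eLpNorm X 2 μ ^ 2 := by
  rw [eLpNorm_eq_lintegral_rpow_enorm_toReal (by simp) (by simp), ← ENNReal.rpow_natCast,
    ← ENNReal.rpow_mul]
  simp only [ENNReal.toReal_ofNat, Nat.cast_ofNat, one_div, ne_eq, OfNat.ofNat_ne_zero,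
    not_false_eq_true, inv_mul_cancel₀, ENNReal.rpow_one]
  refine lintegral_congr fun ω => ?_
  rw [← sq_abs, ENNReal.ofReal_pow (abs_nonneg _), ← Real.norm_eq_abs, ofReal_norm,
    ENNReal.rpow_ofNat]

lemma memLp_two_of_meanSq_ne_top (hX : AEStronglyMeasurable X μ) (h : meanSq μ X ≠ ∞) :
    MemLp X 2 μ := by
  rw [meanSq_eq_eLpNorm_sq, ENNReal.pow_ne_top_iff] at h
  exact ⟨hX, (h.resolve_right two_ne_zero).lt_top⟩

lemma meanSq_const_mul (c : ℝ) (hX : Measurable X) :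
    meanSq μ (fun ω => c * X ω) = ENNReal.ofReal (c ^ 2) * meanSq μ X := by
  unfold meanSq
  rw [← lintegral_const_mul _ (by fun_prop)]
  refine lintegral_congr fun ω => ?_
  rw [← ENNReal.ofReal_mul (sq_nonneg c), mul_pow]

end

lemma integral_sq_sub_condExp_le {m m₀ : MeasurableSpace Ω} {μ : Measure Ω} [IsFiniteMeasure μ]
    (hm : m ≤ m₀) {X Y : Ω → ℝ} (hX : MemLp X 2 μ) (hY : MemLp Y 2 μ)
    (hYm : StronglyMeasurable[m] Y) :
    ∫ ω, (X ω - (μ[X | m]) ω) ^ 2 ∂μ ≤ ∫ ω, (X ω - Y ω) ^ 2 ∂μ := by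
  have hcondExp : μ[X - Y | m] =ᵐ[μ] μ[X | m] - Y := by
    refine (condExp_sub (hX.integrable one_le_two) (hY.integrable one_le_two) m).trans ?_
    rw [condExp_of_stronglyMeasurable hm hYm (hY.integrable one_le_two)]
  calc ∫ ω, (X ω - (μ[X | m]) ω) ^ 2 ∂μ = ∫ ω, (Var[X - Y; μ | m]) ω ∂μ := by
        rw [condVar, integral_condExp hm]
        refine integral_congr_ae ?_
        filter_upwards [hcondExp] with ω h
        simp only [Pi.pow_apply, Pi.sub_apply] at h ⊢
        rw [h]
        ring
    _ ≤ ∫ ω, (μ[(X - Y) ^ 2 | m]) ω ∂μ :=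
        integral_mono_ae integrable_condVar integrable_condExp
          (condVar_ae_le_condExp_sq hm (hX.sub hY))
    _ = ∫ ω, (X ω - Y ω) ^ 2 ∂μ := integral_condExp hm

lemma exists_boundedContinuous_meanSq_sub_comp_lt {T : Type*} [MeasurableSpace Ω]
    [MeasurableSpace T] [TopologicalSpace T] [TopologicalSpace.PseudoMetrizableSpace T]
    [BorelSpace T] {μ : Measure Ω} [IsFiniteMeasure μ] {X : Ω → ℝ} {O : Ω → T} {h : T → ℝ}
    {C : ℝ≥0∞} (hX : AEStronglyMeasurable X μ) (hO : Measurable O) (hh : Measurable h)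
    (hhO : MemLp (fun ω => h (O ω)) 2 μ) (hC : meanSq μ (fun ω => X ω - h (O ω)) < C) :
    ∃ k : BoundedContinuousFunction T ℝ, meanSq μ (fun ω => X ω - k (O ω)) < C := by
  have hL2 : MemLp h 2 (μ.map O) :=
    (memLp_map_measure_iff hh.aestronglyMeasurable hO.aemeasurable).2 hhO
  simp only [meanSq_eq_eLpNorm_sq] at hC ⊢
  set A := eLpNorm (fun ω => X ω - h (O ω)) 2 μ
  obtain ⟨e, he, heA⟩ : ∃ e : ℝ≥0∞, 0 < e ∧ (A + e) ^ 2 < C := by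
    have hcont : Continuous fun e : ℝ≥0∞ => (A + e) ^ 2 :=
      (ENNReal.continuous_pow 2).comp (continuous_const.add continuous_id)
    have hev := (hcont.tendsto 0).eventually_lt_const (by simpa only [add_zero] using hC)
    exact ((eventually_mem_nhdsWithin (s := Ioi 0)).and
      (hev.filter_mono nhdsWithin_le_nhds)).exists
  obtain ⟨k, hk, -⟩ := hL2.exists_boundedContinuous_eLpNorm_sub_le (by simp) he.ne'
  have hkm : Measurable k := k.continuous.measurable
  rw [eLpNorm_map_measure (hh.sub hkm).aestronglyMeasurable hO.aemeasurable] at hk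
  refine ⟨k, lt_of_le_of_lt ?_ heA⟩
  gcongr
  calc eLpNorm (fun ω => X ω - k (O ω)) 2 μ
      = eLpNorm ((fun ω => X ω - h (O ω)) + (h - ⇑k) ∘ O) 2 μ := by
        congr 1
        funext ω
        simp
    _ ≤ A + eLpNorm ((h - ⇑k) ∘ O) 2 μ :=
        eLpNorm_add_le (hX.sub hhO.aestronglyMeasurable)
          ((hh.sub hkm).comp hO).aestronglyMeasurable one_le_two
    _ ≤ A + e := by gcongr

end MeanSq

lemma memLp_id_gaussian : MemLp (fun x : ℝ => x) 2 γ :=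
  memLp_id_gaussianReal' 2 (by simp)

lemma integral_sq_gaussian : ∫ x, x ^ 2 ∂γ = 1 := by
  have := variance_id_gaussianReal (μ := 0) (v := 1)
  rw [variance_eq_integral (by fun_prop)] at this
  simpa using this

lemma meanSq_affine_gaussian (a b : ℝ) :
    meanSq γ (fun x => a + b * x) = ENNReal.ofReal (a ^ 2 + b ^ 2) := by
  have hid : Integrable (fun x : ℝ => x) γ := memLp_id_gaussian.integrable one_le_two
  have hlin : Integrable (fun x : ℝ => 2 * a * b * x) γ := hid.const_mul _
  have hsq : Integrable (fun x : ℝ => b ^ 2 * x ^ 2) γ :=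
    memLp_id_gaussian.integrable_sq.const_mul _
  have hquad : Integrable (fun x : ℝ => 2 * a * b * x + b ^ 2 * x ^ 2) γ := hlin.add hsq
  have hexpand : ∀ x : ℝ, (a + b * x) ^ 2 = a ^ 2 + (2 * a * b * x + b ^ 2 * x ^ 2) :=
    fun x => by ring
  have hL2 : MemLp (fun x : ℝ => a + b * x) 2 γ :=
    (memLp_const a).add (memLp_id_gaussian.const_mul b)
  rw [meanSq_eq_ofReal_integral hL2]
  simp_rw [hexpand]
  rw [integral_add (integrable_const _) hquad, integral_add hlin hsq,
    integral_const_mul, integral_const_mul, integral_sq_gaussian]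
  simp [integral_id_gaussianReal]

lemma map_rotation_gaussian {a b : ℝ} (hab : a ^ 2 + b ^ 2 = 1) :
    γ².map (fun ω : ℝ × ℝ => (a * ω.1 + b * ω.2, -b * ω.1 + a * ω.2)) = γ² := by
  have hnorm : ‖(⟨a, b⟩ : ℂ)‖ = 1 := by simp [Complex.norm_def, Complex.normSq_apply, ← sq, hab]
  have hne : (⟨a, b⟩ : ℂ) ≠ 0 := norm_ne_zero_iff.1 (by rw [hnorm]; exact one_ne_zero)
  have := IsGaussian.map_rotation_eq_self (μ := γ) (by simp) (Complex.arg ⟨a, b⟩)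
  simpa [ContinuousLinearMap.rotation, Complex.cos_arg hne, Complex.sin_arg, hnorm] using this

lemma measurePreserving_reflection_gaussian {a b : ℝ} (hab : a ^ 2 + b ^ 2 = 1) :
    MeasurePreserving (fun ω : ℝ × ℝ => (a * ω.1 + b * ω.2, b * ω.1 - a * ω.2))
      γ² γ² := by
  have hneg : MeasurePreserving (fun x : ℝ => -x) γ γ :=
    ⟨measurable_neg, by simpa using gaussianReal_map_neg (μ := 0) (v := 1)⟩
  have hflip := (MeasurePreserving.id γ).prod hneg
  have hrot : MeasurePreserving (fun ω : ℝ × ℝ => (a * ω.1 + b * ω.2, -b * ω.1 + a * ω.2))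
      γ² γ² := ⟨by fun_prop, map_rotation_gaussian hab⟩
  convert hflip.comp hrot using 2 with ω
  simp only [Function.comp, Prod.map, id]
  ring_nf

/-! ### The conditional MMSE in Gaussian noise -/

section CondMMSE

variable {Ω S : Type*} [MeasurableSpace Ω] [MeasurableSpace S] {μ : Measure Ω}
  {Z : Ω → ℝ} {U : Ω → S} {s t : ℝ}

/-- The observation `(√s Z + N, U)` from which `condMMSE μ Z U s` estimates `Z`. -/
abbrev observation (Z : Ω → ℝ) (U : Ω → S) (s : ℝ) : Ω × ℝ → ℝ × S :=
  fun ω => (√s * Z ω.1 + ω.2, U ω.1)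

/-- The mean square error of the estimator `h` of `Z` from the observation `(√s Z + N, U)`. -/
def estErr (μ : Measure Ω) (Z : Ω → ℝ) (U : Ω → S) (s : ℝ) (h : ℝ × S → ℝ) : ℝ≥0∞ :=
  meanSq (μ.prod γ) (fun ω => Z ω.1 - h (observation Z U s ω))

lemma condMMSE_nonneg (μ : Measure Ω) (Z : Ω → ℝ) (U : Ω → S) (s : ℝ) :
    0 ≤ condMMSE μ Z U s :=
  integral_nonneg fun _ => sq_nonneg _

lemma measurable_observation (hZ : Measurable Z) (hU : Measurable U) (s : ℝ) :
    Measurable (observation Z U s) :=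
  Measurable.prodMk (by fun_prop) (hU.comp measurable_fst)

lemma exists_estErr_eq_condMMSE (hZ2 : MemLp Z 2 μ) (U : Ω → S) (s : ℝ) :
    ∃ h : ℝ × S → ℝ, Measurable h ∧ estErr μ Z U s h = ENNReal.ofReal (condMMSE μ Z U s) ∧
      MemLp (fun ω => h (observation Z U s ω)) 2 (μ.prod γ) := by
  have hZ2' : MemLp (fun ω : Ω × ℝ => Z ω.1) 2 (μ.prod γ) :=
    hZ2.comp_measurePreserving measurePreserving_fst
  obtain ⟨h, hh, hcond⟩ := (stronglyMeasurable_condExp (μ := μ.prod γ)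
    (m := MeasurableSpace.comap (observation Z U s) inferInstance)
    (f := fun ω : Ω × ℝ => Z ω.1)).exists_eq_measurable_comp
  have hest : MemLp (fun ω => h (observation Z U s ω)) 2 (μ.prod γ) := by
    have := hZ2'.condExp one_le_two
      (m := MeasurableSpace.comap (observation Z U s) inferInstance)
    rwa [hcond] at this
  refine ⟨h, hh.measurable, ?_, hest⟩
  have herr : MemLp (fun ω => Z ω.1 - h (observation Z U s ω)) 2 (μ.prod γ) := hZ2'.sub hest
  rw [estErr, meanSq_eq_ofReal_integral herr, condMMSE, hcond]
  rfl

variable [IsProbabilityMeasure μ]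

lemma ofReal_condMMSE_le_estErr (hZ : Measurable Z) (hZ2 : MemLp Z 2 μ) (hU : Measurable U)
    (s : ℝ) {h : ℝ × S → ℝ} (hh : Measurable h) :
    ENNReal.ofReal (condMMSE μ Z U s) ≤ estErr μ Z U s h := by
  by_cases hfin : estErr μ Z U s h = ∞
  · exact hfin ▸ le_top
  have hobs := measurable_observation hZ hU s
  have hZ2' : MemLp (fun ω : Ω × ℝ => Z ω.1) 2 (μ.prod γ) :=
    hZ2.comp_measurePreserving measurePreserving_fst
  have herr := memLp_two_of_meanSq_ne_top (by fun_prop) hfin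
  have hest : MemLp (fun ω => h (observation Z U s ω)) 2 (μ.prod γ) := by
    simpa [Pi.sub_def] using hZ2'.sub herr
  rw [estErr, meanSq_eq_ofReal_integral herr]
  exact ENNReal.ofReal_le_ofReal (integral_sq_sub_condExp_le hobs.comap_le hZ2' hest
    (hh.comp (comap_measurable _)).stronglyMeasurable)

lemma lintegral_reflect_noise {c d : ℝ} (hcd : c ^ 2 + d ^ 2 = 1) {F : Ω × ℝ × ℝ → ℝ≥0∞}
    (hF : Measurable F) :
    ∫⁻ w, ∫⁻ ω : Ω × ℝ, F (ω.1, c * ω.2 + d * w, d * ω.2 - c * w) ∂(μ.prod γ) ∂γ =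
      ∫⁻ ω : Ω × ℝ, ∫⁻ w, F (ω.1, ω.2, w) ∂γ ∂(μ.prod γ) := by
  rw [lintegral_lintegral_swap (by fun_prop), lintegral_prod _ (by fun_prop),
    lintegral_prod _ (Measurable.lintegral_prod_right' (f := fun p : (Ω × ℝ) × ℝ =>
      F (p.1.1, p.1.2, p.2)) (by fun_prop)).aemeasurable]
  refine lintegral_congr fun z => ?_
  have := (measurePreserving_reflection_gaussian hcd).lintegral_comp (f := fun p => F (z, p))
    (by fun_prop)
  rw [lintegral_prod _ (by fun_prop), lintegral_prod _ (by fun_prop)] at this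
  exact this

lemma lintegral_sq_combination_eq (hZ : Measurable Z) (hU : Measurable U) {h : ℝ × S → ℝ}
    (hh : Measurable h) (s α β : ℝ) :
    ∫⁻ ω, ∫⁻ w, ENNReal.ofReal ((α * (Z ω.1 - h (observation Z U s ω)) - β * w) ^ 2) ∂γ
      ∂(μ.prod γ) = ENNReal.ofReal (α ^ 2) * estErr μ Z U s h + ENNReal.ofReal (β ^ 2) := by
  have hinner : ∀ e : ℝ, ∫⁻ w, ENNReal.ofReal ((α * e - β * w) ^ 2) ∂γ =
      ENNReal.ofReal (α ^ 2) * ENNReal.ofReal (e ^ 2) + ENNReal.ofReal (β ^ 2) := fun e => by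
    have := meanSq_affine_gaussian (α * e) (-β)
    rw [meanSq, mul_pow, neg_sq, ENNReal.ofReal_add (by positivity) (by positivity),
      ENNReal.ofReal_mul (by positivity)] at this
    simpa only [neg_mul, ← sub_eq_add_neg] using this
  simp_rw [hinner]
  rw [lintegral_add_right _ (by fun_prop), lintegral_const_mul _ (by fun_prop), estErr, meanSq]
  simp

lemma condMMSE_add_le_combination (hZ : Measurable Z) (hZ2 : MemLp Z 2 μ) (hU : Measurable U)
    (hs : 0 ≤ s) (ht : 0 < t) {α β : ℝ} (hαβ : α + β * √t = 1) :
    condMMSE μ Z U (s + t) ≤ α ^ 2 * condMMSE μ Z U s + β ^ 2 := by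
  obtain ⟨h, hh, herr, -⟩ := exists_estErr_eq_condMMSE hZ2 U s
  have : 0 < √(s + t) := Real.sqrt_pos.2 (by linarith)
  obtain ⟨c, hc⟩ : ∃ c, c * √(s + t) = √s := ⟨√s / √(s + t), by field_simp⟩
  obtain ⟨d, hd⟩ : ∃ d, d * √(s + t) = √t := ⟨√t / √(s + t), by field_simp⟩
  have hcd : c ^ 2 + d ^ 2 = 1 := by
    have : (c ^ 2 + d ^ 2) * √(s + t) ^ 2 = √s ^ 2 + √t ^ 2 := by rw [← hc, ← hd]; ring
    rw [Real.sq_sqrt hs, Real.sq_sqrt ht.le, Real.sq_sqrt (by linarith)] at this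
    exact mul_right_cancel₀ (by linarith : s + t ≠ 0) (this.trans (one_mul _).symm)
  -- Reflecting `(N, W)`, with `W` an independent standard Gaussian, splits `√(s + t) Z + N` into
  -- independent observations `√s Z + N₁` and `√t Z + N₂`; combine the best estimate from the
  -- first linearly with the second.
  let est : ℝ → ℝ × S → ℝ := fun w p => α * h (c * p.1 + d * w, p.2) + β * (d * p.1 - c * w)
  have hrandomised : ENNReal.ofReal (condMMSE μ Z U (s + t)) ≤
      ENNReal.ofReal (α ^ 2 * condMMSE μ Z U s + β ^ 2) :=
    calc ENNReal.ofReal (condMMSE μ Z U (s + t))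
        = ∫⁻ _, ENNReal.ofReal (condMMSE μ Z U (s + t)) ∂γ := by simp
      _ ≤ ∫⁻ w, estErr μ Z U (s + t) (est w) ∂γ := lintegral_mono fun w =>
          ofReal_condMMSE_le_estErr hZ hZ2 hU _ (by fun_prop)
      _ = ∫⁻ w, ∫⁻ ω : Ω × ℝ, ENNReal.ofReal ((α * (Z ω.1 - h (√s * Z ω.1 + (c * ω.2 + d * w),
            U ω.1)) - β * (d * ω.2 - c * w)) ^ 2) ∂(μ.prod γ) ∂γ := by
          refine lintegral_congr fun w => lintegral_congr fun ω => ?_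
          have hfirst : c * (√(s + t) * Z ω.1 + ω.2) + d * w =
              √s * Z ω.1 + (c * ω.2 + d * w) := by rw [← hc]; ring
          simp only [est, hfirst]
          congr 2
          linear_combination (-Z ω.1) * hαβ + (-β * Z ω.1) * hd
      _ = ENNReal.ofReal (α ^ 2) * estErr μ Z U s h + ENNReal.ofReal (β ^ 2) :=
          (lintegral_reflect_noise hcd (F := fun q => ENNReal.ofReal
            ((α * (Z q.1 - h (√s * Z q.1 + q.2.1, U q.1)) - β * q.2.2) ^ 2)) (by fun_prop)).trans
            (lintegral_sq_combination_eq hZ hU hh s α β)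
      _ = ENNReal.ofReal (α ^ 2 * condMMSE μ Z U s + β ^ 2) := by
          rw [herr, ← ENNReal.ofReal_mul (sq_nonneg α), ← ENNReal.ofReal_add
            (mul_nonneg (sq_nonneg α) (condMMSE_nonneg _ _ _ _)) (sq_nonneg β)]
  have := condMMSE_nonneg μ Z U s
  exact (ENNReal.ofReal_le_ofReal_iff (by positivity)).1 hrandomised

lemma condMMSE_add_le (hZ : Measurable Z) (hZ2 : MemLp Z 2 μ) (hU : Measurable U)
    (hs : 0 ≤ s) (ht : 0 < t) :
    condMMSE μ Z U (s + t) ≤ condMMSE μ Z U s / (1 + t * condMMSE μ Z U s) := by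
  have hm := condMMSE_nonneg μ Z U s
  set m := condMMSE μ Z U s
  have hsqrt : √t ^ 2 = t := Real.sq_sqrt ht.le
  -- The minimiser of `α² m + β²` subject to `α + β √t = 1`.
  refine (condMMSE_add_le_combination hZ hZ2 hU hs ht (α := 1 / (1 + t * m))
    (β := √t * m / (1 + t * m)) (by field_simp; linear_combination m * hsqrt)).trans_eq ?_
  field_simp
  rw [hsqrt]
  ring

lemma condMMSE_antitoneOn (hZ : Measurable Z) (hZ2 : MemLp Z 2 μ) (hU : Measurable U) :
    AntitoneOn (condMMSE μ Z U) (Ici 0) := by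
  intro s hs s' _ hss'
  rcases hss'.eq_or_lt with rfl | hlt
  · exact le_rfl
  have hm := condMMSE_nonneg μ Z U s
  have ht : 0 < s' - s := sub_pos.2 hlt
  have := condMMSE_add_le hZ hZ2 hU hs ht
  rw [add_sub_cancel] at this
  exact this.trans (div_le_self hm (by nlinarith [mul_nonneg ht.le hm]))

variable [TopologicalSpace S] [SecondCountableTopology S] [BorelSpace S]

lemma continuous_estErr (hZ : Measurable Z) (hZ2 : MemLp Z 2 μ) (hU : Measurable U)
    (k : BoundedContinuousFunction (ℝ × S) ℝ) : Continuous fun s => estErr μ Z U s k := by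
  have hkm : Measurable k := k.continuous.measurable
  refine continuous_iff_continuousAt.2 fun s => tendsto_lintegral_filter_of_dominated_convergence
    (fun ω => ENNReal.ofReal (2 * Z ω.1 ^ 2 + 2 * ‖k‖ ^ 2)) ?_ ?_ ?_ ?_
  · exact .of_forall fun s' => by fun_prop
  · refine .of_forall fun s' => ae_of_all _ fun ω => ENNReal.ofReal_le_ofReal ?_
    have hbound := k.norm_coe_le_norm (observation Z U s' ω)
    set y := k (observation Z U s' ω)
    have hsq : y ^ 2 ≤ ‖k‖ ^ 2 := by rw [← sq_abs y]; gcongr; exact hbound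
    nlinarith [sq_nonneg (Z ω.1 + y)]
  · have hint : Integrable (fun ω : Ω × ℝ => 2 * Z ω.1 ^ 2 + 2 * ‖k‖ ^ 2) (μ.prod γ) :=
      ((hZ2.comp_measurePreserving measurePreserving_fst).integrable_sq.const_mul 2).add
        (integrable_const _)
    exact hint.lintegral_lt_top.ne
  · refine ae_of_all _ fun ω => ENNReal.tendsto_ofReal ?_
    have : Continuous fun s' : ℝ => (Z ω.1 - k (observation Z U s' ω)) ^ 2 := by fun_prop
    exact this.tendsto s

variable [TopologicalSpace.PseudoMetrizableSpace S]

lemma exists_boundedContinuous_estErr_lt (hZ : Measurable Z) (hZ2 : MemLp Z 2 μ)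
    (hU : Measurable U) (s : ℝ) {ε : ℝ} (hε : 0 < ε) :
    ∃ k : BoundedContinuousFunction (ℝ × S) ℝ,
      estErr μ Z U s k < ENNReal.ofReal (condMMSE μ Z U s + ε) := by
  obtain ⟨h, hh, herr, hest⟩ := exists_estErr_eq_condMMSE hZ2 U s
  have hlt : estErr μ Z U s h < ENNReal.ofReal (condMMSE μ Z U s + ε) := by
    have := condMMSE_nonneg μ Z U s
    rw [herr]
    exact (ENNReal.ofReal_lt_ofReal_iff (by linarith)).2 (by linarith)
  exact exists_boundedContinuous_meanSq_sub_comp_lt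
    (hZ.comp measurable_fst).aestronglyMeasurable (measurable_observation hZ hU s) hh hest hlt

lemma upperSemicontinuous_condMMSE (hZ : Measurable Z) (hZ2 : MemLp Z 2 μ) (hU : Measurable U) :
    UpperSemicontinuous (condMMSE μ Z U) := by
  intro s m hm
  obtain ⟨k, hk⟩ := exists_boundedContinuous_estErr_lt hZ hZ2 hU s (sub_pos.2 hm)
  rw [add_sub_cancel] at hk
  filter_upwards [(continuous_estErr hZ hZ2 hU k).continuousAt.eventually_lt_const hk] with s' hs'
  have := (ofReal_condMMSE_le_estErr hZ hZ2 hU s' k.continuous.measurable).trans_lt hs'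
  exact (ENNReal.ofReal_lt_ofReal_iff ((condMMSE_nonneg μ Z U s).trans_lt hm)).1 this

end CondMMSE

/-! ### The error `mmseZ` and the map `phi` -/

section MmseZ

variable {f : ℝ → ℝ} {v w : ℝ}

/-- The mean square error of the estimator `h` of an independent Gaussian `W` from
`(Y, f (√(1-v) Y + √v W))`, where `Y` (the rescaled observation) and `W` are `ω.1` and `ω.2`. -/
def residErr (f : ℝ → ℝ) (v : ℝ) (h : ℝ × ℝ → ℝ) : ℝ≥0∞ :=
  meanSq γ² (fun ω => ω.2 - h (ω.1, f (√(1 - v) * ω.1 + √v * ω.2)))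

-- The reflection that maps `(Z, N)` to `(Y, W)` with `Y = √(1-v) Z + √v N` gives back
-- `Z = √(1-v) Y + √v W`: estimating `Z` from `Y` and `f Z` amounts to estimating `√v W`.
lemma estErr_eq_residErr (hf : Measurable f) (hv : v ∈ Ioc 0 1) {h : ℝ × ℝ → ℝ}
    (hh : Measurable h) :
    estErr γ (fun z => z) f (v⁻¹ - 1)
        (fun p => √(1 - v) * (√v * p.1) + √v * h (√v * p.1, p.2)) =
      ENNReal.ofReal v * residErr f v h := by
  have hv0 : v ≠ 0 := hv.1.ne'
  have ha : √v ^ 2 = v := Real.sq_sqrt hv.1.le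
  have hb : √(1 - v) ^ 2 = 1 - v := Real.sq_sqrt (by linarith [hv.2])
  have hscale : √(v⁻¹ - 1) * √v = √(1 - v) := by
    rw [← Real.sqrt_mul' _ hv.1.le]
    congr 1
    field_simp
  have hresid : ENNReal.ofReal v * residErr f v h = meanSq γ² (fun x : ℝ × ℝ =>
      √v * (x.2 - h (x.1, f (√(1 - v) * x.1 + √v * x.2)))) := by
    rw [meanSq_const_mul _ (by fun_prop), ha, residErr]
  set a := √v
  set b := √(1 - v)
  have hreflect := (measurePreserving_reflection_gaussian (a := b) (b := a)
    (by rw [ha, hb]; ring)).lintegral_comp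
    (f := fun x : ℝ × ℝ => ENNReal.ofReal ((a * (x.2 - h (x.1, f (b * x.1 + a * x.2)))) ^ 2))
    (by fun_prop)
  rw [hresid, meanSq, ← hreflect]
  refine lintegral_congr fun ω => ?_
  have hY : a * (√(v⁻¹ - 1) * ω.1 + ω.2) = b * ω.1 + a * ω.2 := by rw [← hscale]; ring
  have hZ : b * (b * ω.1 + a * ω.2) + a * (a * ω.1 - b * ω.2) = ω.1 := by
    linear_combination ω.1 * ha + ω.1 * hb
  simp only [hY, hZ]
  congr 2
  linear_combination -hZ

lemma mmseZ_nonneg (f : ℝ → ℝ) (v : ℝ) : 0 ≤ mmseZ f v := condMMSE_nonneg _ _ _ _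

lemma ofReal_mmseZ_le_residErr (hf : Measurable f) (hv : v ∈ Ioc 0 1) {h : ℝ × ℝ → ℝ}
    (hh : Measurable h) : ENNReal.ofReal (mmseZ f v) ≤ ENNReal.ofReal v * residErr f v h := by
  rw [← estErr_eq_residErr hf hv hh]
  exact ofReal_condMMSE_le_estErr measurable_id memLp_id_gaussian hf _ (by fun_prop)

lemma exists_residErr_eq_mmseZ (hf : Measurable f) (hv : v ∈ Ioc 0 1) :
    ∃ h : ℝ × ℝ → ℝ, Measurable h ∧
      ENNReal.ofReal v * residErr f v h = ENNReal.ofReal (mmseZ f v) := by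
  obtain ⟨h, hh, herr, -⟩ := exists_estErr_eq_condMMSE memLp_id_gaussian f (v⁻¹ - 1)
  have : √v ≠ 0 := (Real.sqrt_pos.2 hv.1).ne'
  refine ⟨fun p => (√v)⁻¹ * (h ((√v)⁻¹ * p.1, p.2) - √(1 - v) * p.1), by fun_prop, ?_⟩
  rw [← estErr_eq_residErr hf hv (by fun_prop)]
  refine Eq.trans ?_ herr
  congr 1
  funext p
  field_simp
  ring_nf

lemma meanSq_snd_gaussian : meanSq γ² (fun ω => ω.2) = 1 := by
  have hfub := integral_fun_snd (μ := γ) (ν := γ) (fun x : ℝ => x ^ 2)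
  rw [meanSq_eq_ofReal_integral (X := fun ω : ℝ × ℝ => ω.2)
    (memLp_id_gaussian.comp_measurePreserving measurePreserving_snd), hfub]
  simp [integral_sq_gaussian]

lemma mmseZ_le_self (hf : Measurable f) (hv : v ∈ Ioc 0 1) : mmseZ f v ≤ v := by
  have hzero : residErr f v (fun _ => 0) = 1 := by
    simp only [residErr, sub_zero, meanSq_snd_gaussian]
  have hle := ofReal_mmseZ_le_residErr hf hv (h := fun _ => 0) measurable_const
  rw [hzero, mul_one] at hle
  exact (ENNReal.ofReal_le_ofReal_iff hv.1.le).1 hle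

lemma mmseZ_monotoneOn (hf : Measurable f) : MonotoneOn (mmseZ f) (Ioc 0 1) := by
  intro v hv w hw hvw
  have hsnr : w⁻¹ ≤ v⁻¹ := inv_anti₀ hv.1 hvw
  have hw1 : 1 ≤ w⁻¹ := (one_le_inv₀ hw.1).2 hw.2
  exact condMMSE_antitoneOn measurable_id memLp_id_gaussian hf (sub_nonneg.2 hw1)
    (sub_nonneg.2 (hw1.trans hsnr)) (sub_le_sub_right hsnr 1)

lemma upperSemicontinuousAt_mmseZ (hf : Measurable f) (hv : v ≠ 0) :
    UpperSemicontinuousAt (mmseZ f) v :=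
  UpperSemicontinuousAt.comp (g := fun w : ℝ => w⁻¹ - 1)
    (upperSemicontinuous_condMMSE measurable_id memLp_id_gaussian hf _)
    ((continuousAt_inv₀ hv).sub_const 1)

/-- The reciprocal `1 / mmse_z(v) - 1 / v` of `φ(v)`. -/
def psi (f : ℝ → ℝ) (v : ℝ) : ℝ := (mmseZ f v)⁻¹ - v⁻¹

lemma inv_add_le_inv_of_le_div {a b t : ℝ} (hb : 0 < b) (ha : 0 < a) (h : b ≤ a / (1 + t * a)) :
    a⁻¹ + t ≤ b⁻¹ := by
  have := inv_anti₀ hb h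
  rwa [inv_div, add_div, mul_div_cancel_right₀ _ ha.ne', one_div] at this

lemma psi_anti (hf : Measurable f) (hv : v ∈ Ioc 0 1) (hw : w ∈ Ioc 0 1) (hvw : v ≤ w)
    (hpos : 0 < mmseZ f v) : psi f w ≤ psi f v := by
  rcases hvw.eq_or_lt with rfl | hlt
  · exact le_rfl
  have hsnr : w⁻¹ < v⁻¹ := inv_strictAnti₀ hv.1 hlt
  have hw1 : 1 ≤ w⁻¹ := (one_le_inv₀ hw.1).2 hw.2
  have hle := condMMSE_add_le measurable_id memLp_id_gaussian hf (sub_nonneg.2 hw1)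
    (sub_pos.2 hsnr)
  rw [show w⁻¹ - 1 + (v⁻¹ - w⁻¹) = v⁻¹ - 1 by ring] at hle
  have := inv_add_le_inv_of_le_div hpos (hpos.trans_le (mmseZ_monotoneOn hf hv hw hvw)) hle
  unfold psi
  linarith

lemma psi_nonneg (hf : Measurable f) (hv : v ∈ Ioc 0 1) (hpos : 0 < mmseZ f v) : 0 ≤ psi f v :=
  sub_nonneg.2 (inv_anti₀ hpos (mmseZ_le_self hf hv))

lemma phi_of_mmseZ_pos (hv : 0 < v) (hpos : 0 < mmseZ f v) :
    phi f v = (ENNReal.ofReal (psi f v))⁻¹ := by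
  rw [phi, psi, if_neg hv.ne', ENNReal.ofReal_sub _ (inv_nonneg.2 hv.le),
    ENNReal.ofReal_inv_of_pos hpos, ENNReal.ofReal_inv_of_pos hv]

lemma phi_of_mmseZ_eq_zero (hv : 0 < v) (h0 : mmseZ f v = 0) : phi f v = 0 := by
  rw [phi, if_neg hv.ne', h0, ← ENNReal.ofReal_inv_of_pos hv]
  simp

lemma phi_monotoneOn_Ioc (hf : Measurable f) : MonotoneOn (phi f) (Ioc 0 1) := by
  intro v hv w hw hvw
  rcases (mmseZ_nonneg f v).eq_or_lt with h | h
  · simp [phi_of_mmseZ_eq_zero hv.1 h.symm]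
  · rw [phi_of_mmseZ_pos hv.1 h,
      phi_of_mmseZ_pos hw.1 (h.trans_le (mmseZ_monotoneOn hf hv hw hvw))]
    exact ENNReal.inv_le_inv.2 (ENNReal.ofReal_le_ofReal (psi_anti hf hv hw hvw h))

lemma tendsto_phi_sInf (hf : Measurable f) :
    Tendsto (phi f) (𝓝[>] 0) (𝓝 (sInf (phi f '' Ioo 0 1))) :=
  ((phi_monotoneOn_Ioc hf).mono Ioo_subset_Ioc_self).tendsto_nhdsWithin_Ioo_right
    (nonempty_Ioo.2 one_pos) (OrderBot.bddBelow _)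

lemma phi_zero (hf : Measurable f) : phi f 0 = sInf (phi f '' Ioo 0 1) := by
  conv_lhs => unfold phi
  rw [if_pos rfl]
  refine Tendsto.limUnder_eq ((tendsto_phi_sInf hf).congr' ?_)
  filter_upwards [self_mem_nhdsWithin] with w (hw : 0 < w)
  rw [phi, if_neg hw.ne']

lemma tendsto_phi_zero (hf : Measurable f) : Tendsto (phi f) (𝓝[>] 0) (𝓝 (phi f 0)) :=
  phi_zero hf ▸ tendsto_phi_sInf hf

lemma phi_monotoneOn (hf : Measurable f) : MonotoneOn (phi f) (Icc 0 1) := by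
  intro v hv w hw hvw
  rcases hv.1.eq_or_lt with rfl | hv0
  · rcases hw.1.eq_or_lt with rfl | hw0
    · exact le_rfl
    · have hmem : w / 2 ∈ Ioo (0 : ℝ) 1 := ⟨by linarith, by linarith [hw.2]⟩
      rw [phi_zero hf]
      exact (sInf_le (mem_image_of_mem _ hmem)).trans
        (phi_monotoneOn_Ioc hf (Ioo_subset_Ioc_self hmem) ⟨hw0, hw.2⟩ (by linarith))
  · exact phi_monotoneOn_Ioc hf ⟨hv0, hv.2⟩ ⟨hv0.trans_le hvw, hw.2⟩ hvw

end MmseZ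

lemma IsAdmissible.measurable {f : ℝ → ℝ} (hf : IsAdmissible f) : Measurable f := by
  obtain ⟨K, I, hI, -, hcover, hpiece⟩ := hf.pieces
  have hlift : f = liftCover I (fun k x => f x) (fun _ _ _ _ _ => rfl) hcover := by
    funext x
    obtain ⟨k, hk⟩ := mem_iUnion.1 (hcover.ge (mem_univ x))
    rw [liftCover_of_mem hk]
  rw [hlift]
  exact measurable_liftCover I (fun k => (hI k).measurableSet) _ (fun k =>
    (continuousOn_iff_continuous_domRestrict.1 (hpiece k).1.continuousOn).measurable) _ hcover

/-! ### Spectral laws and the map `Phi` -/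

/-- A probability law on `(0,∞)` with mean `δ`: a limiting spectrum whose support may reach `0` and
be unbounded. -/
structure IsPositiveLaw (δ : ℝ) (P : Measure ℝ) : Prop where
  prob : IsProbabilityMeasure P
  ae_pos : ∀ᵐ l ∂P, 0 < l
  integrable : Integrable (fun l => l) P
  mean : ∫ l, l ∂P = δ

lemma IsLimitingSpectrum.isPositiveLaw {δ : ℝ} {P : Measure ℝ} (hP : IsLimitingSpectrum δ P) :
    IsPositiveLaw δ P := by
  have := hP.prob
  obtain ⟨a, b, ha, hsupp⟩ := hP.support
  have hIcc : ∀ᵐ l ∂P, l ∈ Icc a b := mem_ae_iff.2 hsupp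
  refine ⟨hP.prob, hIcc.mono fun l hl => ha.trans_le hl.1,
    Integrable.of_bound aestronglyMeasurable_id b ?_, hP.mean⟩
  filter_upwards [hIcc] with l hl
  rw [Real.norm_of_nonneg (ha.le.trans hl.1)]
  exact hl.2

/-- The mean `E[λ / (1 + x λ)]`, `λ ∼ P`, that is `meanHarm P (1 / x)` in terms of the
precision `x`. -/
def harm (P : Measure ℝ) (x : ℝ) : ℝ := ∫ l, l / (1 + x * l) ∂P

/-- The reciprocal `δ / E[λ / (1 + x λ)] - x` of `Φ(1 / x)`. -/
def Psi (δ : ℝ) (P : Measure ℝ) (x : ℝ) : ℝ := δ / harm P x - x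

lemma exists_eq_inv_ofReal {w : ℝ≥0∞} (hw : w ≠ 0) :
    ∃ x : ℝ, 0 ≤ x ∧ w = (ENNReal.ofReal x)⁻¹ :=
  ⟨w⁻¹.toReal, ENNReal.toReal_nonneg, by rw [ENNReal.ofReal_toReal (by simpa using hw), inv_inv]⟩

lemma Phi_zero (δ : ℝ) (P : Measure ℝ) : Phi δ P 0 = 0 := if_pos rfl

lemma Phi_nonneg (δ : ℝ) (P : Measure ℝ) (w : ℝ≥0∞) : 0 ≤ Phi δ P w := by
  unfold Phi
  split_ifs
  · exact le_rfl
  · exact ENNReal.toReal_nonneg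

lemma mse_mono (P : Measure ℝ) [IsFiniteMeasure P] : Monotone (mse P) := by
  intro w w' h
  refine ENNReal.toReal_mono ?_ (lintegral_mono fun l => ?_)
  · refine ne_top_of_le_ne_top (b := ∫⁻ _l, 1 ∂P) (by simp) ?_
    exact lintegral_mono fun l => ENNReal.inv_le_one.2 le_self_add
  · exact ENNReal.inv_le_inv.2 (add_le_add_right (ENNReal.div_le_div_left h _) 1)

lemma integral_pos_of_ae_pos {α : Type*} [MeasurableSpace α] {μ : Measure α} [NeZero μ]
    {F : α → ℝ} (hpos : ∀ᵐ a ∂μ, 0 < F a) (hF : Integrable F μ) : 0 < ∫ a, F a ∂μ := by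
  have hsupp : F.support =ᵐ[μ] univ := eventuallyEq_univ.2 (hpos.mono fun _ h => h.ne')
  refine (integral_pos_iff_support_of_nonneg_ae (hpos.mono fun _ h => h.le) hF).2 ?_
  rw [measure_congr hsupp]
  exact Measure.measure_univ_pos.2 (NeZero.ne μ)

-- The tangent at `c` of the concave function `y ↦ y / (1 + t y)` lies above it.
lemma div_one_add_mul_le_tangent {t c y : ℝ} (ht : 0 ≤ t) (hc : 0 ≤ c) (hy : 0 ≤ y) :
    y / (1 + t * y) ≤ c / (1 + t * c) + (y - c) / (1 + t * c) ^ 2 := by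
  have hgap : c / (1 + t * c) + (y - c) / (1 + t * c) ^ 2 - y / (1 + t * y) =
      t * (y - c) ^ 2 / ((1 + t * c) ^ 2 * (1 + t * y)) := by
    field_simp
    ring
  have : 0 ≤ t * (y - c) ^ 2 / ((1 + t * c) ^ 2 * (1 + t * y)) := by positivity
  linarith

lemma div_one_add_mul_le_self {x l : ℝ} (hx : 0 ≤ x) (hl : 0 ≤ l) : l / (1 + x * l) ≤ l :=
  div_le_self hl (by linarith [mul_nonneg hx hl])

namespace IsPositiveLaw

variable {δ : ℝ} {P : Measure ℝ} {x y : ℝ}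

lemma mean_pos (hP : IsPositiveLaw δ P) : 0 < δ := by
  have := hP.prob
  exact hP.mean ▸ integral_pos_of_ae_pos hP.ae_pos hP.integrable

lemma integrable_harm (hP : IsPositiveLaw δ P) (hx : 0 ≤ x) :
    Integrable (fun l => l / (1 + x * l)) P := by
  refine hP.integrable.mono' (Measurable.aestronglyMeasurable (by fun_prop)) ?_
  filter_upwards [hP.ae_pos] with l hl
  rw [Real.norm_of_nonneg (by positivity)]
  exact div_one_add_mul_le_self hx hl.le

lemma harm_pos (hP : IsPositiveLaw δ P) (hx : 0 ≤ x) : 0 < harm P x := by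
  have := hP.prob
  refine integral_pos_of_ae_pos ?_ (hP.integrable_harm hx)
  filter_upwards [hP.ae_pos] with l hl
  positivity

lemma harm_zero (hP : IsPositiveLaw δ P) : harm P 0 = δ := by
  simp [harm, hP.mean]

lemma mul_harm_le_one (hP : IsPositiveLaw δ P) (hx : 0 ≤ x) : x * harm P x ≤ 1 := by
  have := hP.prob
  rw [harm, ← integral_const_mul]
  calc ∫ l, x * (l / (1 + x * l)) ∂P ≤ ∫ _, (1 : ℝ) ∂P := by
        refine integral_mono_ae ((hP.integrable_harm hx).const_mul x) (integrable_const _) ?_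
        filter_upwards [hP.ae_pos] with l hl
        have : 0 < 1 + x * l := by positivity
        rw [← mul_div_assoc, div_le_one this]
        linarith
    _ = 1 := by simp

lemma harm_add_le (hP : IsPositiveLaw δ P) (hx : 0 ≤ x) {t : ℝ} (ht : 0 ≤ t) :
    harm P (x + t) ≤ harm P x / (1 + t * harm P x) := by
  have := hP.prob
  have hpos := hP.harm_pos hx
  set c := harm P x with hc
  have hint := hP.integrable_harm hx
  have hdev : Integrable (fun l => (l / (1 + x * l) - c) / (1 + t * c) ^ 2) P :=
    (hint.sub (integrable_const c)).div_const _
  calc harm P (x + t)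
      ≤ ∫ l, (c / (1 + t * c) + (l / (1 + x * l) - c) / (1 + t * c) ^ 2) ∂P := by
        refine integral_mono_ae (hP.integrable_harm (by positivity))
          ((integrable_const _).add hdev) ?_
        filter_upwards [hP.ae_pos] with l hl
        have hsplit : l / (1 + (x + t) * l) =
            l / (1 + x * l) / (1 + t * (l / (1 + x * l))) := by
          field_simp
          ring
        rw [hsplit]
        exact div_one_add_mul_le_tangent ht hpos.le (by positivity)
    _ = c / (1 + t * c) := by
        rw [integral_add (integrable_const _) hdev,
          integral_div _ (fun l => l / (1 + x * l) - c), integral_sub hint (integrable_const c),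
          ← harm, ← hc]
        simp

lemma Psi_monotoneOn (hP : IsPositiveLaw δ P) (hδ : 1 ≤ δ) : MonotoneOn (Psi δ P) (Ici 0) := by
  intro x hx y hy hxy
  have hle := hP.harm_add_le hx (sub_nonneg.2 hxy)
  rw [add_sub_cancel] at hle
  have hinv := inv_add_le_inv_of_le_div (hP.harm_pos hy) (hP.harm_pos hx) hle
  simp only [Psi, div_eq_mul_inv]
  nlinarith

lemma one_le_Psi (hP : IsPositiveLaw δ P) (hδ : 1 ≤ δ) (hx : 0 ≤ x) : 1 ≤ Psi δ P x := by
  have := hP.Psi_monotoneOn hδ self_mem_Ici hx hx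
  rwa [Psi, hP.harm_zero, div_self hP.mean_pos.ne', sub_zero] at this

lemma continuousOn_harm (hP : IsPositiveLaw δ P) : ContinuousOn (harm P) (Ici 0) := by
  refine continuousOn_of_dominated (fun x hx => (hP.integrable_harm hx).aestronglyMeasurable)
    (fun x hx => ?_) hP.integrable ?_
  · filter_upwards [hP.ae_pos] with l hl
    have : 0 ≤ x := hx
    rw [Real.norm_of_nonneg (by positivity)]
    exact div_one_add_mul_le_self hx hl.le
  · filter_upwards [hP.ae_pos] with l hl
    refine ContinuousOn.div (by fun_prop) (by fun_prop) fun x (hx : 0 ≤ x) => ?_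
    positivity

lemma continuousOn_Psi (hP : IsPositiveLaw δ P) : ContinuousOn (Psi δ P) (Ici 0) :=
  (continuousOn_const.div hP.continuousOn_harm fun _ hx => (hP.harm_pos hx).ne').sub
    continuousOn_id

lemma meanHarm_eq (hP : IsPositiveLaw δ P) (hx : 0 ≤ x) :
    meanHarm P (ENNReal.ofReal x)⁻¹ = ENNReal.ofReal (harm P x) := by
  have hnonneg : 0 ≤ᵐ[P] fun l => l / (1 + x * l) := by
    filter_upwards [hP.ae_pos] with l hl
    simp only [Pi.zero_apply]
    positivity
  rw [harm, meanHarm, ofReal_integral_eq_lintegral_ofReal (hP.integrable_harm hx) hnonneg]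
  refine lintegral_congr_ae ?_
  filter_upwards [hP.ae_pos] with l hl
  rw [inv_inv, ← ENNReal.ofReal_inv_of_pos hl, ← ENNReal.ofReal_add hx (by positivity),
    ← ENNReal.ofReal_inv_of_pos (by positivity)]
  congr 1
  field_simp
  ring

lemma Phi_eq (hP : IsPositiveLaw δ P) (hδ : 1 ≤ δ) (hx : 0 ≤ x) :
    Phi δ P (ENNReal.ofReal x)⁻¹ = (Psi δ P x)⁻¹ := by
  have hδ0 := hP.mean_pos
  have hpos := hP.harm_pos hx
  have hdiv : (δ⁻¹ * harm P x)⁻¹ = δ / harm P x := by field_simp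
  rw [Phi, if_neg (by simp), hP.meanHarm_eq hx, inv_inv, ← ENNReal.ofReal_inv_of_pos hδ0,
    ← ENNReal.ofReal_mul (by positivity), ← ENNReal.ofReal_inv_of_pos (by positivity),
    ← ENNReal.ofReal_sub _ hx, ENNReal.toReal_inv, hdiv, ← Psi,
    ENNReal.toReal_ofReal (zero_le_one.trans (hP.one_le_Psi hδ hx))]

lemma mse_eq (hP : IsPositiveLaw δ P) (hx : 0 ≤ x) :
    mse P (ENNReal.ofReal x)⁻¹ = 1 - x * harm P x := by
  have := hP.prob
  have hint := (hP.integrable_harm hx).const_mul x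
  have hinv : ∀ l, 0 < l → 1 - x * (l / (1 + x * l)) = (1 + x * l)⁻¹ := fun l hl => by
    field_simp
    ring
  have hnonneg : ∀ᵐ l ∂P, 0 ≤ 1 - x * (l / (1 + x * l)) := by
    filter_upwards [hP.ae_pos] with l hl
    rw [hinv l hl]
    positivity
  have hintegral : 1 - x * harm P x = ∫ l, (1 - x * (l / (1 + x * l))) ∂P := by
    rw [integral_sub (integrable_const _) hint, integral_const_mul]
    simp [harm]
  rw [hintegral, integral_eq_lintegral_of_nonneg_ae hnonneg
    ((integrable_const _).sub hint).aestronglyMeasurable, mse]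
  congr 1
  refine lintegral_congr_ae ?_
  filter_upwards [hP.ae_pos] with l hl
  rw [hinv l hl, ENNReal.div_eq_inv_mul, inv_inv, ← ENNReal.ofReal_mul hx, ← ENNReal.ofReal_one,
    ← ENNReal.ofReal_add zero_le_one (by positivity), ← ENNReal.ofReal_inv_of_pos (by positivity)]

lemma mse_zero (hP : IsPositiveLaw δ P) : mse P 0 = 0 := by
  rw [mse, lintegral_congr_ae (g := fun _ => 0)]
  · simp
  · filter_upwards [hP.ae_pos] with l hl
    simp [ENNReal.div_zero (ENNReal.ofReal_pos.2 hl).ne']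

lemma Phi_pos (hP : IsPositiveLaw δ P) (hδ : 1 ≤ δ) {w : ℝ≥0∞} (hw : w ≠ 0) : 0 < Phi δ P w := by
  obtain ⟨x, hx, rfl⟩ := exists_eq_inv_ofReal hw
  rw [hP.Phi_eq hδ hx]
  exact inv_pos.2 (zero_lt_one.trans_le (hP.one_le_Psi hδ hx))

lemma Phi_le_one (hP : IsPositiveLaw δ P) (hδ : 1 ≤ δ) (w : ℝ≥0∞) : Phi δ P w ≤ 1 := by
  rcases eq_or_ne w 0 with rfl | hw
  · simp [Phi_zero]
  · obtain ⟨x, hx, rfl⟩ := exists_eq_inv_ofReal hw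
    rw [hP.Phi_eq hδ hx]
    exact inv_le_one_of_one_le₀ (hP.one_le_Psi hδ hx)

lemma Phi_mono (hP : IsPositiveLaw δ P) (hδ : 1 ≤ δ) : Monotone (Phi δ P) := by
  intro w w' h
  rcases eq_or_ne w 0 with rfl | hw
  · exact Phi_zero δ P ▸ Phi_nonneg _ _ _
  obtain ⟨x, hx, rfl⟩ := exists_eq_inv_ofReal hw
  obtain ⟨y, hy, rfl⟩ := exists_eq_inv_ofReal (pos_iff_ne_zero.2 hw |>.trans_le h).ne'
  have hyx : y ≤ x := (ENNReal.ofReal_le_ofReal_iff hx).1 (ENNReal.inv_le_inv.1 h)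
  rw [hP.Phi_eq hδ hx, hP.Phi_eq hδ hy]
  exact inv_anti₀ (zero_lt_one.trans_le (hP.one_le_Psi hδ hy)) (hP.Psi_monotoneOn hδ hy hx hyx)

lemma Phi_le_Phi {P' : Measure ℝ} (hP : IsPositiveLaw δ P) (hP' : IsPositiveLaw δ P')
    (hδ : 1 ≤ δ)
    (hharm : ∀ x, 0 ≤ x → harm P x ≤ harm P' x) (w : ℝ≥0∞) : Phi δ P w ≤ Phi δ P' w := by
  rcases eq_or_ne w 0 with rfl | hw
  · simp [Phi_zero]
  obtain ⟨x, hx, rfl⟩ := exists_eq_inv_ofReal hw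
  rw [hP.Phi_eq hδ hx, hP'.Phi_eq hδ hx]
  refine inv_anti₀ (zero_lt_one.trans_le (hP'.one_le_Psi hδ hx)) (sub_le_sub_right ?_ x)
  exact div_le_div_of_nonneg_left hP.mean_pos.le (hP.harm_pos hx) (hharm x hx)

end IsPositiveLaw

/-! ### Quantiles and the Lorenz order -/

section Quantile

variable (P : Measure ℝ) {x y : ℝ}

lemma bddAbove_setOf_cdf_le (hy : y < 1) : BddAbove {x : ℝ | cdf P x ≤ y} := by
  obtain ⟨b, hb⟩ := ((tendsto_cdf_atTop P).eventually_const_lt hy).exists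
  exact ⟨b, fun x (hx : cdf P x ≤ y) => ((monotone_cdf P).reflect_lt (hx.trans_lt hb)).le⟩

lemma nonempty_setOf_cdf_le (hy : 0 < y) : {x : ℝ | cdf P x ≤ y}.Nonempty :=
  ((tendsto_cdf_atBot P).eventually_le_const hy).exists

lemma quantile_monotoneOn : MonotoneOn (quantile P) (Ioo 0 1) :=
  fun _ hy _ hz hyz => csSup_le_csSup (bddAbove_setOf_cdf_le P hz.2)
    (nonempty_setOf_cdf_le P hy.1) fun _ hx => le_trans hx hyz

lemma aemeasurable_quantile : AEMeasurable (quantile P) (volume.restrict (Ioo 0 1)) :=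
  aemeasurable_restrict_of_monotoneOn measurableSet_Ioo (quantile_monotoneOn P)

lemma quantile_le_of_lt_cdf (hy : 0 < y) (hyx : y < cdf P x) : quantile P y ≤ x :=
  csSup_le (nonempty_setOf_cdf_le P hy) fun _ hz =>
    ((monotone_cdf P).reflect_lt (lt_of_le_of_lt hz hyx)).le

lemma le_cdf_of_quantile_le (hy : y < 1) (hyx : quantile P y ≤ x) : y ≤ cdf P x := by
  by_contra! hlt
  have hright : ContinuousWithinAt (cdf P) (Ioi x) x :=
    ((cdf P).right_continuous x).mono Ioi_subset_Ici_self
  obtain ⟨z, hz, hxz⟩ :=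
    ((hright.eventually_lt_const hlt).and self_mem_nhdsWithin).exists
  exact not_le.2 hxz ((le_csSup (bddAbove_setOf_cdf_le P hy) hz.le).trans hyx)

lemma intervalIntegral_quantile {u : ℝ} (hu : 0 ≤ u) :
    ∫ y in (0 : ℝ)..u, quantile P y = ∫ y in Ioo 0 u, quantile P y := by
  rw [intervalIntegral.integral_of_le hu, integral_Ioc_eq_integral_Ioo]

variable [IsProbabilityMeasure P]

lemma map_quantile : (volume.restrict (Ioo (0 : ℝ) 1)).map (quantile P) = P := by
  have hq := aemeasurable_quantile P
  have : IsProbabilityMeasure (volume.restrict (Ioo (0 : ℝ) 1)) := ⟨by simp⟩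
  have := Measure.isProbabilityMeasure_map hq
  refine Measure.ext_of_Iic _ _ fun x => ?_
  rw [Measure.map_apply_of_aemeasurable hq measurableSet_Iic,
    Measure.restrict_apply₀' measurableSet_Ioo.nullMeasurableSet, ← ofReal_cdf]
  apply le_antisymm
  · calc volume (quantile P ⁻¹' Iic x ∩ Ioo 0 1) ≤ volume (Ioc 0 (cdf P x)) :=
          measure_mono fun y hy => ⟨hy.2.1, le_cdf_of_quantile_le P hy.2.2 hy.1⟩
      _ = ENNReal.ofReal (cdf P x) := by simp
  · calc ENNReal.ofReal (cdf P x) = volume (Ioo 0 (cdf P x)) := by simp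
      _ ≤ volume (quantile P ⁻¹' Iic x ∩ Ioo 0 1) := measure_mono fun y hy =>
          ⟨quantile_le_of_lt_cdf P hy.1 hy.2, hy.1, hy.2.trans_le (cdf_le_one P x)⟩

lemma integral_comp_quantile {F : ℝ → ℝ} (hF : Measurable F) :
    ∫ y in Ioo 0 1, F (quantile P y) = ∫ l, F l ∂P := by
  conv_rhs => rw [← map_quantile P]
  rw [integral_map (aemeasurable_quantile P) hF.aestronglyMeasurable]

lemma integrableOn_comp_quantile {F : ℝ → ℝ} (hF : Integrable F P) :
    IntegrableOn (fun y => F (quantile P y)) (Ioo 0 1) := by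
  rw [← map_quantile P] at hF
  exact hF.comp_aemeasurable (aemeasurable_quantile P)

lemma quantile_dirac (c : ℝ) (hy : y ∈ Ioo (0 : ℝ) 1) : quantile (Measure.dirac c) y = c := by
  have hset : {x | cdf (Measure.dirac c) x ≤ y} = Iio c := by
    ext x
    rw [mem_ofPred_eq, cdf_eq_real, mem_Iio]
    rcases lt_or_ge x c with hx | hx
    · simp [measureReal_def, hx, hy.1.le]
    · simp [measureReal_def, hx, hx.not_gt, hy.2.not_ge]
  rw [quantile, hset, csSup_Iio]

end Quantile

section Rearrangement

variable {a b : ℝ} {k D : ℝ → ℝ}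

lemma exists_Ioo_ae_eq_superlevel_of_antitoneOn (hab : a ≤ b) (hk : AntitoneOn k (Ioo a b))
    (t : ℝ) : ∃ u ∈ Icc a b, ({y | t < k y} ∩ Ioo a b : Set ℝ) =ᵐ[volume] Ioo a u := by
  set B := {y | t < k y} ∩ Ioo a b with hB
  have hbound : ∀ y ∈ insert a B, y ≤ b := by
    rintro y (rfl | hy)
    · exact hab
    · exact hy.2.2.le
  have hbdd : BddAbove (insert a B) := ⟨b, hbound⟩
  refine ⟨sSup (insert a B),
    ⟨le_csSup hbdd (mem_insert a B), csSup_le (insert_nonempty a B) hbound⟩, ?_⟩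
  have hupper : B ⊆ Ioc a (sSup (insert a B)) := fun y hy =>
    ⟨hy.2.1, le_csSup hbdd (mem_insert_of_mem a hy)⟩
  have hlower : Ioo a (sSup (insert a B)) ⊆ B := fun y hy => by
    obtain ⟨z, rfl | hz, hyz⟩ := exists_lt_of_lt_csSup (insert_nonempty a B) hy.2
    · exact absurd hyz hy.1.not_gt
    · have hmem : y ∈ Ioo a b := ⟨hy.1, hyz.trans hz.2.2⟩
      exact ⟨lt_of_lt_of_le hz.1 (hk hmem hz.2 hyz.le), hmem⟩
  exact (hupper.eventuallyLE.trans Ioo_ae_eq_Ioc.symm.le).antisymm hlower.eventuallyLE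

-- Writing `k y` as the length of `{t ∈ (0,C) | t < k y}`, Fubini turns the integral into an
-- average over `t` of the integrals of `D` over the superlevel sets of `k`.
lemma setIntegral_antitone_mul_nonneg {C : ℝ} (hab : a ≤ b) (hk : AntitoneOn k (Ioo a b))
    (hkC : ∀ y ∈ Ioo a b, k y ∈ Icc 0 C) (hD : IntegrableOn D (Ioo a b))
    (h : ∀ u ∈ Icc a b, 0 ≤ ∫ y in Ioo a u, D y) : 0 ≤ ∫ y in Ioo a b, k y * D y := by
  have hkm : AEMeasurable k (volume.restrict (Ioo a b)) :=
    aemeasurable_restrict_of_antitoneOn measurableSet_Ioo hk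
  have hlayer : ∀ y ∈ Ioo a b,
      k y * D y = ∫ t in Ioo 0 C, {t | t < k y}.indicator (fun _ => D y) t := fun y hy => by
    have hinter : Ioo 0 C ∩ {t | t < k y} = Ioo 0 (k y) := by
      ext t
      exact ⟨fun ht => ⟨ht.1.1, ht.2⟩, fun ht => ⟨⟨ht.1, ht.2.trans_le (hkC y hy).2⟩, ht.2⟩⟩
    rw [setIntegral_indicator (s := Ioo 0 C) (t := {t | t < k y}) measurableSet_Iio, hinter]
    simp [(hkC y hy).1]
  have hint : Integrable (Function.uncurry fun y t => {t | t < k y}.indicator (fun _ => D y) t)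
      ((volume.restrict (Ioo a b)).prod (volume.restrict (Ioo 0 C))) := by
    have hset : NullMeasurableSet {p : ℝ × ℝ | p.2 < k p.1}
        ((volume.restrict (Ioo a b)).prod (volume.restrict (Ioo 0 C))) :=
      nullMeasurableSet_lt measurable_snd.aemeasurable hkm.comp_fst
    exact (hD.comp_fst _).indicator₀ hset
  rw [setIntegral_congr_fun measurableSet_Ioo hlayer, integral_integral_swap hint]
  refine integral_nonneg fun t => ?_
  obtain ⟨u, hu, hsuper⟩ := exists_Ioo_ae_eq_superlevel_of_antitoneOn hab hk t
  have hnull : NullMeasurableSet {y | t < k y} (volume.restrict (Ioo a b)) :=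
    nullMeasurableSet_lt aemeasurable_const hkm
  calc 0 ≤ ∫ y in Ioo a u, D y := h u hu
    _ = ∫ y in {y | t < k y} ∩ Ioo a b, D y := (setIntegral_congr_set hsuper).symm
    _ = ∫ y in Ioo a b, {y | t < k y}.indicator D y := by
        rw [integral_indicator₀ hnull, Measure.restrict_restrict₀ hnull]

lemma integrableOn_antitone_mul {C : ℝ} (hk : AntitoneOn k (Ioo a b))
    (hkC : ∀ y ∈ Ioo a b, k y ∈ Icc 0 C) (hD : IntegrableOn D (Ioo a b)) :
    IntegrableOn (fun y => k y * D y) (Ioo a b) := by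
  refine hD.bdd_mul (c := C)
    (aemeasurable_restrict_of_antitoneOn measurableSet_Ioo hk).aestronglyMeasurable ?_
  filter_upwards [ae_restrict_mem measurableSet_Ioo] with y hy
  rw [Real.norm_of_nonneg (hkC y hy).1]
  exact (hkC y hy).2

-- Both averages are compared with the value at `u`.
lemma setIntegral_monotone_le_mul {Q : ℝ → ℝ} (hQ : MonotoneOn Q (Ioo 0 1))
    (hint : IntegrableOn Q (Ioo 0 1)) {u : ℝ} (hu : u ∈ Icc (0 : ℝ) 1) :
    ∫ y in Ioo 0 u, Q y ≤ u * ∫ y in Ioo 0 1, Q y := by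
  rcases hu.2.eq_or_lt with rfl | hu1
  · simp
  rcases hu.1.eq_or_lt with rfl | hu0
  · simp
  have hleft : IntegrableOn Q (Ioo 0 u) := hint.mono_set (Ioo_subset_Ioo_right hu1.le)
  have hright : IntegrableOn Q (Ico u 1) := hint.mono_set (Ico_subset_Ioo_left hu0)
  have hsplit : ∫ y in Ioo 0 1, Q y = (∫ y in Ioo 0 u, Q y) + ∫ y in Ico u 1, Q y := by
    rw [← Ioo_union_Ico_eq_Ioo hu0 hu1.le]
    exact setIntegral_union (disjoint_left.2 fun y h1 h2 => h2.1.not_gt h1.2)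
      measurableSet_Ico hleft hright
  have hbelow : ∫ y in Ioo 0 u, Q y ≤ u * Q u := by
    calc ∫ y in Ioo 0 u, Q y ≤ ∫ _y in Ioo 0 u, Q u :=
          setIntegral_mono_on hleft (integrable_const _) measurableSet_Ioo fun y hy =>
            hQ ⟨hy.1, hy.2.trans hu1⟩ ⟨hu0, hu1⟩ hy.2.le
      _ = u * Q u := by simp [hu0.le]
  have habove : (1 - u) * Q u ≤ ∫ y in Ico u 1, Q y := by
    calc (1 - u) * Q u = ∫ _y in Ico u 1, Q u := by simp [hu1.le]
      _ ≤ ∫ y in Ico u 1, Q y :=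
          setIntegral_mono_on (integrable_const _) hright measurableSet_Ico fun y hy =>
            hQ ⟨hu0, hu1⟩ ⟨hu0.trans_le hy.1, hy.2⟩ hy.1
  nlinarith

end Rearrangement

section Lorenz

variable {δ : ℝ} {P P₁ P₂ : Measure ℝ}

lemma IsPositiveLaw.quantile_nonneg (hP : IsPositiveLaw δ P) {y : ℝ} (hy : y ∈ Ioo (0 : ℝ) 1) :
    0 ≤ quantile P y := by
  have := hP.prob
  refine le_csSup (bddAbove_setOf_cdf_le P hy.2) ?_
  have hzero : P (Iic 0) = 0 :=
    measure_mono_null (fun l (hl : l ≤ 0) => not_lt.2 hl) (mem_ae_iff.1 hP.ae_pos)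
  rw [mem_ofPred_eq, cdf_eq_real, measureReal_def, hzero, ENNReal.toReal_zero]
  exact hy.1.le

lemma IsPositiveLaw.integrableOn_quantile (hP : IsPositiveLaw δ P) :
    IntegrableOn (quantile P) (Ioo 0 1) :=
  have := hP.prob
  integrableOn_comp_quantile P hP.integrable

lemma IsPositiveLaw.setIntegral_quantile (hP : IsPositiveLaw δ P) :
    ∫ y in Ioo 0 1, quantile P y = δ :=
  have := hP.prob
  (integral_comp_quantile P measurable_id).trans hP.mean

lemma spikier_iff (h₁ : IsPositiveLaw δ P₁) (h₂ : IsPositiveLaw δ P₂) :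
    Spikier P₁ P₂ ↔
      ∀ u ∈ Icc (0 : ℝ) 1, ∫ y in Ioo 0 u, quantile P₁ y ≤ ∫ y in Ioo 0 u, quantile P₂ y := by
  refine forall₂_congr fun u hu => ?_
  rw [lorenzCurve, lorenzCurve, intervalIntegral_quantile P₁ zero_le_one,
    intervalIntegral_quantile P₂ zero_le_one, h₁.setIntegral_quantile, h₂.setIntegral_quantile,
    div_le_div_iff_of_pos_right h₁.mean_pos, intervalIntegral_quantile P₁ hu.1,
    intervalIntegral_quantile P₂ hu.1]

lemma Spikier.setIntegral_quantile_sub_nonneg (h : Spikier P₁ P₂) (h₁ : IsPositiveLaw δ P₁)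
    (h₂ : IsPositiveLaw δ P₂) {u : ℝ} (hu : u ∈ Icc (0 : ℝ) 1) :
    0 ≤ ∫ y in Ioo 0 u, (quantile P₂ y - quantile P₁ y) := by
  have hsub : Ioo 0 u ⊆ Ioo 0 1 := Ioo_subset_Ioo_right hu.2
  rw [integral_sub (h₂.integrableOn_quantile.mono_set hsub)
    (h₁.integrableOn_quantile.mono_set hsub), sub_nonneg]
  exact (spikier_iff h₁ h₂).1 h u hu

-- With `Q₁`, `Q₂` the quantile functions, the tangent to `l ↦ l / (1 + x l)` at `Q₂ y` bounds the
-- increment from below by `k y * (Q₂ y - Q₁ y)`, where the slope `k` is nonincreasing in `y`.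
lemma Spikier.harm_le (h : Spikier P₁ P₂) (h₁ : IsPositiveLaw δ P₁) (h₂ : IsPositiveLaw δ P₂)
    {x : ℝ} (hx : 0 ≤ x) : harm P₁ x ≤ harm P₂ x := by
  have := h₁.prob
  have := h₂.prob
  set Q₁ := quantile P₁
  set Q₂ := quantile P₂
  set k : ℝ → ℝ := fun y => ((1 + x * Q₂ y) ^ 2)⁻¹ with hk_def
  have hden : ∀ y ∈ Ioo (0 : ℝ) 1, 1 ≤ 1 + x * Q₂ y := fun y hy => by
    linarith [mul_nonneg hx (h₂.quantile_nonneg hy)]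
  have hk : AntitoneOn k (Ioo 0 1) := fun y hy z hz hyz => by
    have hdeny := hden y hy
    have hQ := quantile_monotoneOn P₂ hy hz hyz
    refine inv_anti₀ (by positivity) ?_
    gcongr
  have hk_mem : ∀ y ∈ Ioo (0 : ℝ) 1, k y ∈ Icc 0 1 := fun y hy =>
    ⟨by positivity, inv_le_one_of_one_le₀ (one_le_pow₀ (hden y hy))⟩
  have hD : IntegrableOn (fun y => Q₂ y - Q₁ y) (Ioo 0 1) :=
    h₂.integrableOn_quantile.sub h₁.integrableOn_quantile
  have hF₁ := integrableOn_comp_quantile P₁ (h₁.integrable_harm hx)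
  have hF₂ := integrableOn_comp_quantile P₂ (h₂.integrable_harm hx)
  have hF : Measurable fun l : ℝ => l / (1 + x * l) := by fun_prop
  rw [← sub_nonneg, harm, harm, ← integral_comp_quantile P₁ hF, ← integral_comp_quantile P₂ hF,
    ← integral_sub hF₂ hF₁]
  refine (setIntegral_antitone_mul_nonneg zero_le_one hk hk_mem hD
    (fun _ => h.setIntegral_quantile_sub_nonneg h₁ h₂)).trans (setIntegral_mono_on
      (integrableOn_antitone_mul hk hk_mem hD) (hF₂.sub hF₁) measurableSet_Ioo fun y hy => ?_)
  have htangent :=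
    div_one_add_mul_le_tangent hx (h₂.quantile_nonneg hy) (h₁.quantile_nonneg hy)
  rw [hk_def, mul_comm, ← div_eq_mul_inv, ← neg_sub (Q₁ y), neg_div]
  linarith

lemma isLimitingSpectrum_dirac (hδ : 0 < δ) : IsLimitingSpectrum δ (Measure.dirac δ) where
  prob := inferInstance
  support := ⟨δ, δ, hδ, by simp⟩
  mean := by simp

lemma IsPositiveLaw.spikier_dirac (hP : IsPositiveLaw δ P) : Spikier P (Measure.dirac δ) := by
  have := hP.prob
  rw [spikier_iff hP (isLimitingSpectrum_dirac hP.mean_pos).isPositiveLaw]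
  intro u hu
  calc ∫ y in Ioo 0 u, quantile P y
      ≤ u * ∫ y in Ioo 0 1, quantile P y :=
        setIntegral_monotone_le_mul (quantile_monotoneOn P) hP.integrableOn_quantile hu
    _ = ∫ _y in Ioo 0 u, δ := by simp [hP.setIntegral_quantile, hu.1]
    _ = ∫ y in Ioo 0 u, quantile (Measure.dirac δ) y :=
        setIntegral_congr_fun measurableSet_Ioo fun y hy =>
          (quantile_dirac δ ⟨hy.1, hy.2.trans_le hu.2⟩).symm

end Lorenz

/-! ### Limits of the state evolution -/

section Continuity

variable {f : ℝ → ℝ} {δ v : ℝ} {P : Measure ℝ}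

lemma continuousWithinAt_mmseZ (hf : Measurable f) (hv : v ∈ Ioc (0 : ℝ) 1) :
    ContinuousWithinAt (mmseZ f) (Icc v 1) v := by
  refine tendsto_order.2 ⟨fun a ha => ?_, fun a ha => ?_⟩
  · filter_upwards [self_mem_nhdsWithin] with w hw
    exact ha.trans_le (mmseZ_monotoneOn hf hv ⟨hv.1.trans_le hw.1, hw.2⟩ hw.1)
  · exact nhdsWithin_le_nhds (upperSemicontinuousAt_mmseZ hf hv.1.ne' a ha)

lemma continuousWithinAt_phi (hf : Measurable f) (hv : v ∈ Icc (0 : ℝ) 1) :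
    ContinuousWithinAt (phi f) (Icc v 1) v := by
  rcases hv.1.eq_or_lt with rfl | hv0
  · have hright : ContinuousWithinAt (phi f) (Ioi 0) 0 := tendsto_phi_zero hf
    exact (continuousWithinAt_Ioi_iff_Ici.1 hright).mono Icc_subset_Ici_self
  have hratio : ContinuousWithinAt
      (fun w => ((ENNReal.ofReal (mmseZ f w))⁻¹ - (ENNReal.ofReal w)⁻¹)⁻¹) (Icc v 1) v := by
    refine (ENNReal.Tendsto.sub ?_ ?_ (Or.inr ?_)).inv
    · exact (ENNReal.tendsto_ofReal (continuousWithinAt_mmseZ hf ⟨hv0, hv.2⟩)).inv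
    · exact (ENNReal.continuous_ofReal.continuousWithinAt).inv
    · simpa using hv0
  exact hratio.congr (fun w hw => if_neg (hv0.trans_le hw.1).ne') (if_neg hv0.ne')

lemma continuous_mse (P : Measure ℝ) [IsFiniteMeasure P] : Continuous (mse P) := by
  have hone : ∀ (w : ℝ≥0∞) (l : ℝ), (1 + ENNReal.ofReal l / w)⁻¹ ≤ 1 := fun w l =>
    ENNReal.inv_le_one.2 le_self_add
  refine continuous_iff_continuousAt.2 fun w => ?_
  refine (ENNReal.tendsto_toReal ?_).comp
    (tendsto_lintegral_filter_of_dominated_convergence (fun _ => 1) ?_ ?_ (by simp) ?_)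
  · exact ne_top_of_le_ne_top (b := ∫⁻ _, 1 ∂P) (by simp) (lintegral_mono (hone w))
  · exact Eventually.of_forall fun w => by fun_prop
  · exact Eventually.of_forall fun w => Eventually.of_forall (hone w)
  · exact Eventually.of_forall fun l => (tendsto_const_nhds.add
      (ENNReal.Tendsto.const_div tendsto_id (Or.inr ENNReal.ofReal_ne_top))).inv

lemma IsPositiveLaw.Phi_le_div (hP : IsPositiveLaw δ P) (hδ : 1 < δ) {w : ℝ≥0∞} (hw : w ≠ ∞) :
    Phi δ P w ≤ w.toReal / (δ - 1) := by
  rcases eq_or_ne w 0 with rfl | hw0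
  · simp [Phi_zero]
  obtain ⟨x, hx, rfl⟩ := exists_eq_inv_ofReal hw0
  have hx0 : 0 < x := by simpa using hw
  have : 0 < δ - 1 := sub_pos.2 hδ
  rw [hP.Phi_eq hδ.le hx, ENNReal.toReal_inv, ENNReal.toReal_ofReal hx, ← one_div, ← one_div,
    div_div]
  refine one_div_le_one_div_of_le (by positivity) ?_
  have hle : δ * x ≤ δ / harm P x := by
    rw [le_div_iff₀ (hP.harm_pos hx)]
    nlinarith [hP.mul_harm_le_one hx]
  rw [Psi]
  linarith

lemma IsPositiveLaw.continuous_Phi (hP : IsPositiveLaw δ P) (hδ : 1 < δ) :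
    Continuous (Phi δ P) := by
  refine continuous_iff_continuousAt.2 fun w => ?_
  rcases eq_or_ne w 0 with rfl | hw
  · rw [ContinuousAt, Phi_zero]
    have hbound : Tendsto (fun w : ℝ≥0∞ => w.toReal / (δ - 1)) (𝓝 0) (𝓝 0) := by
      simpa using (ENNReal.tendsto_toReal ENNReal.zero_ne_top).div_const (δ - 1)
    refine tendsto_of_tendsto_of_tendsto_of_le_of_le' tendsto_const_nhds hbound
      (Eventually.of_forall (Phi_nonneg δ P)) ?_
    filter_upwards [Iio_mem_nhds ENNReal.zero_lt_top] with w hw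
    exact hP.Phi_le_div hδ hw.ne
  · have hPhi : Phi δ P =ᶠ[𝓝 w] fun w => (Psi δ P w⁻¹.toReal)⁻¹ := by
      filter_upwards [isOpen_ne.mem_nhds hw] with w hw
      obtain ⟨x, hx, rfl⟩ := exists_eq_inv_ofReal hw
      rw [hP.Phi_eq hδ.le hx, inv_inv, ENNReal.toReal_ofReal hx]
    have hprec : Tendsto (fun w : ℝ≥0∞ => w⁻¹.toReal) (𝓝 w) (𝓝[Ici 0] w⁻¹.toReal) :=
      tendsto_nhdsWithin_iff.2 ⟨(ENNReal.tendsto_toReal (ENNReal.inv_ne_top.2 hw)).comp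
        tendsto_id.inv, Eventually.of_forall fun _ => mem_Ici.2 ENNReal.toReal_nonneg⟩
    have hPsi : 0 < Psi δ P w⁻¹.toReal :=
      zero_lt_one.trans_le (hP.one_le_Psi hδ.le ENNReal.toReal_nonneg)
    refine ContinuousAt.congr ?_ hPhi.symm
    exact ((hP.continuousOn_Psi _ ENNReal.toReal_nonneg).tendsto.comp hprec).inv₀ hPsi.ne'

end Continuity

section Evolution

variable {f : ℝ → ℝ} {δ v : ℝ} {P : Measure ℝ}

lemma Phi_phi_monotoneOn (hf : Measurable f) (hP : IsPositiveLaw δ P) (hδ : 1 ≤ δ) :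
    MonotoneOn (fun v => Phi δ P (phi f v)) (Icc 0 1) :=
  (hP.Phi_mono hδ).comp_monotoneOn (phi_monotoneOn hf)

lemma seVr_mem_Icc (f : ℝ → ℝ) (hP : IsPositiveLaw δ P) (hδ : 1 ≤ δ) (t : ℕ) :
    seVr f δ P t ∈ Icc (0 : ℝ) 1 := by
  cases t with
  | zero => exact ⟨zero_le_one, le_rfl⟩
  | succ t => exact ⟨Phi_nonneg _ _ _, hP.Phi_le_one hδ _⟩

lemma seVr_antitone (hf : Measurable f) (hP : IsPositiveLaw δ P) (hδ : 1 ≤ δ) :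
    Antitone (seVr f δ P) := by
  refine antitone_nat_of_succ_le fun t => ?_
  induction t with
  | zero => exact hP.Phi_le_one hδ _
  | succ t ih =>
    exact Phi_phi_monotoneOn hf hP hδ (seVr_mem_Icc f hP hδ _) (seVr_mem_Icc f hP hδ _) ih

lemma tendsto_seVr (hf : Measurable f) (hP : IsPositiveLaw δ P) (hδ : 1 ≤ δ) :
    Tendsto (seVr f δ P) atTop (𝓝 (Vstar f δ P)) := by
  have hbdd : BddBelow (range (seVr f δ P)) :=
    ⟨0, forall_mem_range.2 fun t => (seVr_mem_Icc f hP hδ t).1⟩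
  exact tendsto_nhds_limUnder ⟨_, tendsto_atTop_ciInf (seVr_antitone hf hP hδ) hbdd⟩

lemma Vstar_le_seVr (hf : Measurable f) (hP : IsPositiveLaw δ P) (hδ : 1 ≤ δ) (t : ℕ) :
    Vstar f δ P ≤ seVr f δ P t :=
  (seVr_antitone hf hP hδ).le_of_tendsto (tendsto_seVr hf hP hδ) t

lemma Vstar_mem_Icc (hf : Measurable f) (hP : IsPositiveLaw δ P) (hδ : 1 ≤ δ) :
    Vstar f δ P ∈ Icc (0 : ℝ) 1 :=
  isClosed_Icc.mem_of_tendsto (tendsto_seVr hf hP hδ)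
    (Eventually.of_forall (seVr_mem_Icc f hP hδ))

lemma le_Vstar (hf : Measurable f) (hP : IsPositiveLaw δ P) (hδ : 1 ≤ δ)
    (hv : v ∈ Icc (0 : ℝ) 1) (hle : v ≤ Phi δ P (phi f v)) : v ≤ Vstar f δ P := by
  refine ge_of_tendsto' (tendsto_seVr hf hP hδ) fun t => ?_
  induction t with
  | zero => exact hv.2
  | succ t ih => exact hle.trans (Phi_phi_monotoneOn hf hP hδ hv (seVr_mem_Icc f hP hδ t) ih)

lemma Phi_phi_Vstar (hf : Measurable f) (hP : IsPositiveLaw δ P) (hδ : 1 < δ) :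
    Phi δ P (phi f (Vstar f δ P)) = Vstar f δ P := by
  have hlim := tendsto_seVr hf hP hδ.le
  have hlim_within : Tendsto (seVr f δ P) atTop (𝓝[Icc (Vstar f δ P) 1] (Vstar f δ P)) :=
    tendsto_nhdsWithin_iff.2 ⟨hlim, Eventually.of_forall fun t =>
      ⟨Vstar_le_seVr hf hP hδ.le t, (seVr_mem_Icc f hP hδ.le t).2⟩⟩
  have hphi := (continuousWithinAt_phi hf (Vstar_mem_Icc hf hP hδ.le)).tendsto.comp hlim_within
  have hstep : Tendsto (fun t => seVr f δ P (t + 1)) atTop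
      (𝓝 (Phi δ P (phi f (Vstar f δ P)))) := ((hP.continuous_Phi hδ).tendsto _).comp hphi
  exact tendsto_nhds_unique hstep (hlim.comp (tendsto_add_atTop_nat 1))

lemma mmseZ_pos_of_phi_ne_zero (hv : 0 < v) (h : phi f v ≠ 0) : 0 < mmseZ f v :=
  (mmseZ_nonneg f v).lt_of_ne fun h0 => h (phi_of_mmseZ_eq_zero hv h0.symm)

lemma Phi_phi_eq (hf : Measurable f) (hP : IsPositiveLaw δ P) (hδ : 1 ≤ δ)
    (hv : v ∈ Ioc (0 : ℝ) 1) (hpos : 0 < mmseZ f v) :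
    (Phi δ P (phi f v))⁻¹ = δ / harm P (psi f v) - psi f v := by
  rw [phi_of_mmseZ_pos hv.1 hpos, hP.Phi_eq hδ (psi_nonneg hf hv hpos), inv_inv, Psi]

lemma Phi_phi_le_iff (hf : Measurable f) (hP : IsPositiveLaw δ P) (hδ : 1 ≤ δ)
    (hv : v ∈ Ioc (0 : ℝ) 1) (hpos : 0 < mmseZ f v) :
    Phi δ P (phi f v) ≤ v ↔ harm P (psi f v) ≤ δ * mmseZ f v := by
  have hψ := psi_nonneg hf hv hpos
  have hPhi : 0 < Phi δ P (phi f v) := hP.Phi_pos hδ (by rw [phi_of_mmseZ_pos hv.1 hpos]; simp)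
  have hsum : v⁻¹ + psi f v = (mmseZ f v)⁻¹ := add_sub_cancel _ _
  rw [← inv_le_inv₀ hv.1 hPhi, Phi_phi_eq hf hP hδ hv hpos, le_sub_iff_add_le, hsum,
    le_div_iff₀ (hP.harm_pos hψ), inv_mul_le_iff₀ hpos, mul_comm]

lemma Phi_phi_lt_iff (hf : Measurable f) (hP : IsPositiveLaw δ P) (hδ : 1 ≤ δ)
    (hv : v ∈ Ioc (0 : ℝ) 1) (hpos : 0 < mmseZ f v) :
    Phi δ P (phi f v) < v ↔ harm P (psi f v) < δ * mmseZ f v := by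
  have hψ := psi_nonneg hf hv hpos
  have hPhi : 0 < Phi δ P (phi f v) := hP.Phi_pos hδ (by rw [phi_of_mmseZ_pos hv.1 hpos]; simp)
  have hsum : v⁻¹ + psi f v = (mmseZ f v)⁻¹ := add_sub_cancel _ _
  rw [← inv_lt_inv₀ hv.1 hPhi, Phi_phi_eq hf hP hδ hv hpos, lt_sub_iff_add_lt, hsum,
    lt_div_iff₀ (hP.harm_pos hψ), inv_mul_lt_iff₀ hpos, mul_comm]

lemma gFun_of_ne_zero (f : ℝ → ℝ) (δ : ℝ) (hv : v ≠ 0) :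
    gFun f δ v = 1 - δ * (1 - mmseZ f v / v) :=
  if_neg hv

lemma psi_mul_mmseZ (hv : v ≠ 0) (hm : mmseZ f v ≠ 0) :
    psi f v * mmseZ f v = 1 - mmseZ f v / v := by
  rw [psi]
  field_simp

lemma mse_phi_eq (hf : Measurable f) (hP : IsPositiveLaw δ P) (hv : v ∈ Ioc (0 : ℝ) 1)
    (hpos : 0 < mmseZ f v) : mse P (phi f v) = 1 - psi f v * harm P (psi f v) := by
  rw [phi_of_mmseZ_pos hv.1 hpos, hP.mse_eq (psi_nonneg hf hv hpos)]

lemma mse_phi_sub_gFun (hf : Measurable f) (hP : IsPositiveLaw δ P)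
    (hv : v ∈ Ioc (0 : ℝ) 1) (hpos : 0 < mmseZ f v) :
    mse P (phi f v) - gFun f δ v = psi f v * (δ * mmseZ f v - harm P (psi f v)) := by
  have hv0 := hv.1.ne'
  rw [mse_phi_eq hf hP hv hpos, gFun_of_ne_zero f δ hv0, ← psi_mul_mmseZ hv0 hpos.ne']
  ring

lemma mse_nonneg (P : Measure ℝ) (w : ℝ≥0∞) : 0 ≤ mse P w := ENNReal.toReal_nonneg

lemma GFun_le_mse (hf : Measurable f) (hP : IsPositiveLaw δ P) (hδ : 1 ≤ δ)
    (hv : v ∈ Ioc (0 : ℝ) 1) (h : Phi δ P (phi f v) ≤ v) : GFun f δ v ≤ mse P (phi f v) := by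
  refine max_le ?_ (mse_nonneg _ _)
  rcases (mmseZ_nonneg f v).eq_or_lt with h0 | hpos
  · rw [gFun_of_ne_zero f δ hv.1.ne', ← h0, phi_of_mmseZ_eq_zero hv.1 h0.symm, hP.mse_zero]
    simpa using hδ
  · rw [← sub_nonneg, mse_phi_sub_gFun hf hP hv hpos]
    exact mul_nonneg (psi_nonneg hf hv hpos)
      (sub_nonneg.2 ((Phi_phi_le_iff hf hP hδ hv hpos).1 h))

lemma mse_phi_eq_GFun (hf : Measurable f) (hP : IsPositiveLaw δ P) (hδ : 1 ≤ δ)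
    (hv : v ∈ Ioc (0 : ℝ) 1) (h : Phi δ P (phi f v) = v) : mse P (phi f v) = GFun f δ v := by
  have hpos : 0 < mmseZ f v := mmseZ_pos_of_phi_ne_zero hv.1 fun h0 => by
    rw [h0, Phi_zero] at h
    exact hv.1.ne h
  have hharm : harm P (psi f v) = δ * mmseZ f v :=
    ((Phi_phi_le_iff hf hP hδ hv hpos).1 h.le).antisymm
      (not_lt.1 fun hlt => h.not_lt ((Phi_phi_lt_iff hf hP hδ hv hpos).2 hlt))
  have hg : mse P (phi f v) = gFun f δ v := by
    rw [← sub_eq_zero, mse_phi_sub_gFun hf hP hv hpos, hharm, sub_self, mul_zero]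
  rw [GFun, ← hg, max_eq_left (mse_nonneg _ _)]

lemma phi_Vstar_eq_zero (hf : Measurable f) (hP : IsPositiveLaw δ P) (hδ : 1 < δ)
    (hV : Vstar f δ P = 0) : phi f (Vstar f δ P) = 0 := by
  by_contra hphi
  have hpos := hP.Phi_pos hδ.le hphi
  rw [Phi_phi_Vstar hf hP hδ] at hpos
  exact hpos.ne' hV

lemma mseStar_eq_zero (hf : Measurable f) (hP : IsPositiveLaw δ P) (hδ : 1 < δ)
    (hV : Vstar f δ P = 0) : mseStar f δ P = 0 := by
  rw [mseStar, phi_Vstar_eq_zero hf hP hδ hV, hP.mse_zero]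

lemma mseStar_eq_GFun (hf : Measurable f) (hP : IsPositiveLaw δ P) (hδ : 1 < δ)
    (hV : 0 < Vstar f δ P) : mseStar f δ P = GFun f δ (Vstar f δ P) :=
  mse_phi_eq_GFun hf hP hδ.le ⟨hV, (Vstar_mem_Icc hf hP hδ.le).2⟩ (Phi_phi_Vstar hf hP hδ)

lemma mseStar_nonneg (f : ℝ → ℝ) (δ : ℝ) (P : Measure ℝ) : 0 ≤ mseStar f δ P := mse_nonneg _ _

-- Above `V⋆` the iteration decreases, so `G ≤ MSE ∘ φ` there, and `MSE ∘ φ` is continuous at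
-- `V⋆` from the right.
lemma le_mseStar_of_forall_le_GFun (hf : Measurable f) (hP : IsPositiveLaw δ P) (hδ : 1 ≤ δ)
    {c : ℝ} (hv : v ∈ Ioc (Vstar f δ P) 1) (h : ∀ w ∈ Ioc (Vstar f δ P) v, c ≤ GFun f δ w) :
    c ≤ mseStar f δ P := by
  have := hP.prob
  have hV := Vstar_mem_Icc hf hP hδ
  have hlim : Tendsto (fun w => mse P (phi f w)) (𝓝[Ioc (Vstar f δ P) v] (Vstar f δ P))
      (𝓝 (mseStar f δ P)) := ((continuous_mse P).tendsto _).comp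
    ((continuousWithinAt_phi hf hV).mono
      fun w hw => ⟨hw.1.le, hw.2.trans hv.2⟩)
  have : (𝓝[Ioc (Vstar f δ P) v] (Vstar f δ P)).NeBot := by
    rw [nhdsWithin_Ioc_eq_nhdsGT hv.1]
    infer_instance
  refine ge_of_tendsto hlim ?_
  filter_upwards [self_mem_nhdsWithin] with w hw
  have hw' : w ∈ Ioc (0 : ℝ) 1 := ⟨hV.1.trans_lt hw.1, hw.2.trans hv.2⟩
  have hdecr : Phi δ P (phi f w) ≤ w := by
    by_contra! hlt
    exact not_le.2 hw.1 (le_Vstar hf hP hδ ⟨hw'.1.le, hw'.2⟩ hlt.le)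
  exact (h w hw).trans (GFun_le_mse hf hP hδ hw' hdecr)

lemma mse_phi_le_mseStar (hf : Measurable f) (hP : IsPositiveLaw δ P) (hδ : 1 ≤ δ)
    (hv : v ∈ Icc (0 : ℝ) 1) (hle : v ≤ Phi δ P (phi f v)) :
    mse P (phi f v) ≤ mseStar f δ P := by
  have := hP.prob
  exact mse_mono P (phi_monotoneOn hf hv (Vstar_mem_Icc hf hP hδ) (le_Vstar hf hP hδ hv hle))

lemma mseStar_le_mse_phi (hf : Measurable f) (hP : IsPositiveLaw δ P) (hδ : 1 < δ)
    (hv : v ∈ Icc (0 : ℝ) 1) (hlt : ∀ w ∈ Ioc v 1, Phi δ P (phi f w) < w) :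
    mseStar f δ P ≤ mse P (phi f v) := by
  have := hP.prob
  have hV := Vstar_mem_Icc hf hP hδ.le
  refine mse_mono P (phi_monotoneOn hf hV hv ?_)
  by_contra! hvV
  exact (hlt _ ⟨hvV, hV.2⟩).ne (Phi_phi_Vstar hf hP hδ)

end Evolution

section Comparison

variable {f : ℝ → ℝ} {δ : ℝ} {P₁ P₂ : Measure ℝ}

lemma Spikier.Vstar_le (h : Spikier P₁ P₂) (hf : Measurable f) (h₁ : IsPositiveLaw δ P₁)
    (h₂ : IsPositiveLaw δ P₂) (hδ : 1 ≤ δ) : Vstar f δ P₁ ≤ Vstar f δ P₂ := by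
  refine le_of_tendsto_of_tendsto' (tendsto_seVr hf h₁ hδ) (tendsto_seVr hf h₂ hδ) fun t => ?_
  induction t with
  | zero => exact le_rfl
  | succ t ih =>
    exact (h₁.Phi_le_Phi h₂ hδ (fun x hx => h.harm_le h₁ h₂ hx) _).trans
      (Phi_phi_monotoneOn hf h₂ hδ (seVr_mem_Icc f h₁ hδ t) (seVr_mem_Icc f h₂ hδ t) ih)

theorem mseStar_le_of_GFun_monotoneOn (h : Spikier P₁ P₂) (hf : Measurable f)
    (h₁ : IsPositiveLaw δ P₁) (h₂ : IsPositiveLaw δ P₂) (hδ : 1 < δ)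
    (hG : MonotoneOn (GFun f δ) (Icc 0 1)) : mseStar f δ P₁ ≤ mseStar f δ P₂ := by
  have hV := h.Vstar_le hf h₁ h₂ hδ.le
  have hV₁ := Vstar_mem_Icc hf h₁ hδ.le
  have hV₂ := Vstar_mem_Icc hf h₂ hδ.le
  rcases hV₁.1.eq_or_lt with h0 | hpos
  · exact (mseStar_eq_zero hf h₁ hδ h0.symm).trans_le (mseStar_nonneg _ _ _)
  · rw [mseStar_eq_GFun hf h₁ hδ hpos, mseStar_eq_GFun hf h₂ hδ (hpos.trans_le hV)]
    exact hG hV₁ hV₂ hV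

theorem mseStar_le_of_GFun_antitoneOn (h : Spikier P₁ P₂) (hf : Measurable f)
    (h₁ : IsPositiveLaw δ P₁) (h₂ : IsPositiveLaw δ P₂) (hδ : 1 < δ)
    (hG : AntitoneOn (GFun f δ) (Icc 0 1)) : mseStar f δ P₂ ≤ mseStar f δ P₁ := by
  have hV₁ := Vstar_mem_Icc hf h₁ hδ.le
  have hV₂ := Vstar_mem_Icc hf h₂ hδ.le
  rcases hV₂.1.eq_or_lt with h0 | hpos
  · exact (mseStar_eq_zero hf h₂ hδ h0.symm).trans_le (mseStar_nonneg _ _ _)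
  rcases (h.Vstar_le hf h₁ h₂ hδ.le).eq_or_lt with heq | hlt
  · rw [mseStar_eq_GFun hf h₂ hδ hpos, mseStar_eq_GFun hf h₁ hδ (heq ▸ hpos), heq]
  · rw [mseStar_eq_GFun hf h₂ hδ hpos]
    exact le_mseStar_of_forall_le_GFun hf h₁ hδ.le ⟨hlt, hV₂.2⟩ fun w hw =>
      hG ⟨hV₁.1.trans hw.1.le, hw.2.trans hV₂.2⟩ hV₂ hw.2

end Comparison

/-! ### Step functions and indicators -/

lemma isAdmissible_comp_of_monotone {K : ℕ} {c : ℝ → Fin K} (hc : Monotone c) (g : Fin K → ℝ) :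
    IsAdmissible (g ∘ c) where
  pieces := by
    refine ⟨K, fun k => c ⁻¹' {k}, fun k => ordConnected_singleton.preimage_mono hc, ?_, ?_,
      fun k => ⟨(contDiffOn_const (c := g k)).congr fun x hx => congrArg g hx,
        Or.inr (Or.inr ⟨g k, fun x hx => congrArg g hx⟩)⟩⟩
    · exact fun i j hij => (disjoint_singleton.2 hij).preimage c
    · exact eq_univ_of_forall fun x => mem_iUnion.2 ⟨c x, rfl⟩
  entropy := by
    refine summable_of_ne_finset_zero (s := Finset.univ.image fun k => ⌊g k⌋) fun n hn => ?_
    have hempty : {z : ℝ | ⌊(g ∘ c) z⌋ = n} = ∅ := eq_empty_of_forall_notMem fun z hz =>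
      hn (Finset.mem_image.2 ⟨c z, Finset.mem_univ _, hz⟩)
    rw [hempty]
    simp

lemma isAdmissible_indicator_Icc (a b : ℝ) : IsAdmissible ((Icc a b).indicator 1) := by
  let c : ℝ → Fin 3 := fun x => if x < a then 0 else if x ≤ b then 1 else 2
  have hc : Monotone c := by
    intro x y hxy
    by_cases hya : y < a
    · simp [c, hya, hxy.trans_lt hya]
    by_cases hyb : y ≤ b
    · by_cases hxa : x < a <;> simp [c, hya, hyb, hxa, hxy.trans hyb]
    · simpa [c, hya, hyb] using Fin.le_last (c x)
  convert isAdmissible_comp_of_monotone hc ![0, 1, 0] using 1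
  funext x
  rcases lt_or_ge x a with hx | hx
  · simp [c, hx]
  · by_cases hxb : x ≤ b <;> simp [c, hx, hxb, not_lt.2 hx]

lemma isOpenPosMeasure_gaussian : Measure.IsOpenPosMeasure γ :=
  (gaussianReal_absolutelyContinuous' 0 one_ne_zero).isOpenPosMeasure

lemma gaussian_le_volume (A : Set ℝ) : γ A ≤ volume A := by
  have hpdf : gaussianPDF 0 1 ≤ 1 := fun x => by
    rw [gaussianPDF_def, Pi.one_apply, ← ENNReal.ofReal_one]
    refine ENNReal.ofReal_le_ofReal ?_
    rw [gaussianPDFReal_def]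
    refine mul_le_one₀ (inv_le_one_of_one_le₀ ?_) (Real.exp_nonneg _) (Real.exp_le_one_iff.2 ?_)
    · rw [Real.one_le_sqrt]
      have := Real.pi_gt_three
      push_cast
      linarith
    · exact div_nonpos_of_nonpos_of_nonneg (neg_nonpos.2 (sq_nonneg _)) (by positivity)
  calc γ A = (volume.withDensity (gaussianPDF 0 1)) A := by
        rw [gaussianReal_of_var_ne_zero 0 one_ne_zero]
    _ ≤ (volume.withDensity 1) A := withDensity_mono (ae_of_all _ hpdf) A
    _ = volume A := by rw [withDensity_one]

section Indicator

variable {f : ℝ → ℝ} {A : Set ℝ} {r v K : ℝ}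

lemma mmseZ_div_le_of_residErr_le (hf : Measurable f) (hv : v ∈ Ioc 0 1) {h : ℝ × ℝ → ℝ}
    (hh : Measurable h) (hK : 0 ≤ K) (hle : residErr f v h ≤ ENNReal.ofReal K) :
    mmseZ f v / v ≤ K := by
  have hmmse : ENNReal.ofReal (mmseZ f v) ≤ ENNReal.ofReal (v * K) := by
    rw [ENNReal.ofReal_mul hv.1.le]
    exact (ofReal_mmseZ_le_residErr hf hv hh).trans (by gcongr)
  rw [div_le_iff₀' hv.1]
  exact (ENNReal.ofReal_le_ofReal_iff (mul_nonneg hv.1.le hK)).1 hmmse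

lemma one_sub_mmseZ_div_le_of_forall (hf : Measurable f) (hv : v ∈ Ioc 0 1) (hK : 0 ≤ K)
    (h : ∀ h : ℝ × ℝ → ℝ, Measurable h → 1 ≤ residErr f v h + ENNReal.ofReal K) :
    1 - mmseZ f v / v ≤ K := by
  obtain ⟨h₀, hh₀, herr⟩ := exists_residErr_eq_mmseZ hf hv
  have hm := mmseZ_nonneg f v
  have hle : ENNReal.ofReal v ≤ ENNReal.ofReal (mmseZ f v + v * K) := by
    rw [ENNReal.ofReal_add hm (mul_nonneg hv.1.le hK), ENNReal.ofReal_mul hv.1.le, ← herr,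
      ← mul_add]
    exact le_mul_of_one_le_right' (h h₀ hh₀)
  have := (ENNReal.ofReal_le_ofReal_iff (add_nonneg hm (mul_nonneg hv.1.le hK))).1 hle
  rw [sub_le_iff_le_add', ← sub_le_iff_le_add, le_div_iff₀ hv.1]
  linarith

lemma mmseZ_one_lt_one (hf : Measurable f) (hf2 : MemLp f 2 γ) (hcorr : ∫ z, z * f z ∂γ ≠ 0) :
    mmseZ f 1 < 1 := by
  set e := ∫ z, z * f z ∂γ
  set s := ∫ z, f z ^ 2 ∂γ
  have hs0 : 0 ≤ s := integral_nonneg fun z => sq_nonneg _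
  have hint : Integrable (fun z => z * f z) γ := memLp_id_gaussian.integrable_mul hf2
  have herr : ∀ t : ℝ, mmseZ f 1 ≤ 1 - 2 * t * e + t ^ 2 * s := fun t => by
    have hL2 : MemLp (fun z => z - t * f z) 2 γ := memLp_id_gaussian.sub (hf2.const_mul t)
    have hexpand : ∀ z, (z - t * f z) ^ 2 = z ^ 2 - 2 * t * (z * f z) + t ^ 2 * f z ^ 2 :=
      fun z => by ring
    have hvalue : ∫ z, (z - t * f z) ^ 2 ∂γ = 1 - 2 * t * e + t ^ 2 * s := by
      have hlin : Integrable (fun z => z ^ 2 - 2 * t * (z * f z)) γ :=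
        memLp_id_gaussian.integrable_sq.sub (hint.const_mul _)
      simp_rw [hexpand]
      rw [integral_add hlin (hf2.integrable_sq.const_mul _),
        integral_sub memLp_id_gaussian.integrable_sq (hint.const_mul _), integral_const_mul,
        integral_const_mul, integral_sq_gaussian]
    have hresid : residErr f 1 (fun p => t * p.2) = meanSq γ (fun z => z - t * f z) := by
      simp only [residErr, meanSq, sub_self, Real.sqrt_zero, Real.sqrt_one, zero_mul, zero_add,
        one_mul]
      exact measurePreserving_snd.lintegral_comp
        (f := fun z : ℝ => ENNReal.ofReal ((z - t * f z) ^ 2)) (by fun_prop)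
    rw [meanSq_eq_ofReal_integral hL2, hvalue] at hresid
    simpa using mmseZ_div_le_of_residErr_le hf (v := 1) (by simp) (by fun_prop)
      (hvalue ▸ integral_nonneg fun z => sq_nonneg _) hresid.le
  refine (herr (e / (1 + s))).trans_lt ?_
  have hgap : 1 - 2 * (e / (1 + s)) * e + (e / (1 + s)) ^ 2 * s =
      1 - (e / (1 + s)) ^ 2 * (2 + s) := by
    field_simp
    ring
  have : 0 < (e / (1 + s)) ^ 2 * (2 + s) := by positivity
  linarith

lemma meanSq_linear_combination (hv : v ∈ Icc 0 1) {F G : ℝ → ℝ} (hF : Measurable F)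
    (hG : Measurable G) :
    meanSq γ² (fun ω => F (√(1 - v) * ω.1 + √v * ω.2) * ω.1 +
        G (√(1 - v) * ω.1 + √v * ω.2) * ω.2) =
      ∫⁻ z, ENNReal.ofReal ((√(1 - v) * F z + √v * G z) ^ 2 * z ^ 2 +
        (√v * F z - √(1 - v) * G z) ^ 2) ∂γ := by
  have hsq : √(1 - v) ^ 2 + √v ^ 2 = 1 := by
    rw [Real.sq_sqrt hv.1, Real.sq_sqrt (sub_nonneg.2 hv.2)]
    ring
  set a := √v
  set b := √(1 - v)
  have hreflect := (measurePreserving_reflection_gaussian hsq).lintegral_comp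
    (f := fun x : ℝ × ℝ => ENNReal.ofReal
      (((b * F x.1 + a * G x.1) * x.1 + (a * F x.1 - b * G x.1) * x.2) ^ 2)) (by fun_prop)
  have hrotate : meanSq γ² (fun ω => F (b * ω.1 + a * ω.2) * ω.1 + G (b * ω.1 + a * ω.2) * ω.2) =
      ∫⁻ ω, ENNReal.ofReal (((b * F (b * ω.1 + a * ω.2) + a * G (b * ω.1 + a * ω.2)) *
        (b * ω.1 + a * ω.2) + (a * F (b * ω.1 + a * ω.2) - b * G (b * ω.1 + a * ω.2)) *
        (a * ω.1 - b * ω.2)) ^ 2) ∂γ² := lintegral_congr fun ω => by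
    congr 2
    linear_combination -(F (b * ω.1 + a * ω.2) * ω.1 + G (b * ω.1 + a * ω.2) * ω.2) * hsq
  rw [hrotate, hreflect, lintegral_prod _ (by fun_prop)]
  refine lintegral_congr fun z => ?_
  rw [← mul_pow, ← meanSq_affine_gaussian]
  rfl

lemma sq_mul_add_sq_le_of_sq_le (hv : v ∈ Ioc 0 1) {z : ℝ} (hz : z ^ 2 ≤ 1 / 4) :
    (√(1 - v) * (√v * √(1 - v) / 2) + √v) ^ 2 * z ^ 2 +
      (√v * (√v * √(1 - v) / 2) - √(1 - v)) ^ 2 ≤ v * z ^ 2 + (1 - v) - v * (1 - v) / 4 := by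
  have ha : √v ^ 2 = v := Real.sq_sqrt hv.1.le
  have hb : √(1 - v) ^ 2 = 1 - v := Real.sq_sqrt (sub_nonneg.2 hv.2)
  set a := √v
  set b := √(1 - v)
  have hexpand : (b * (a * b / 2) + a) ^ 2 * z ^ 2 + (a * (a * b / 2) - b) ^ 2 =
      a ^ 2 * (b ^ 2 / 2 + 1) ^ 2 * z ^ 2 + b ^ 2 * (a ^ 2 / 2 - 1) ^ 2 := by ring
  have hcoef : 1 / 4 ≤ 1 - z ^ 2 - ((1 - v) * z ^ 2 + v) / 4 := by nlinarith [hv.1, hv.2]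
  rw [hexpand, ha, hb]
  nlinarith [mul_le_mul_of_nonneg_left hcoef (mul_nonneg hv.1.le (sub_nonneg.2 hv.2))]

-- Uses the estimator `-(√v √(1 - v) / 2) Y 1_A(Z)` of `W`.
lemma le_one_sub_mmseZ_div_indicator (hA : MeasurableSet A) (hsub : A ⊆ Icc (-(1 / 2)) (1 / 2))
    (hv : v ∈ Ioc 0 1) :
    v * (1 - v) / 4 * Measure.real γ A ≤ 1 - mmseZ (A.indicator 1) v / v := by
  have hf : Measurable (A.indicator (1 : ℝ → ℝ)) := measurable_one.indicator hA
  set a := √v with ha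
  set b := √(1 - v) with hb
  let E : ℝ → ℝ := fun z => v * z ^ 2 + (1 - v) - v * (1 - v) / 4 * A.indicator 1 z
  have hpointwise : ∀ z, (b * (a * b / 2 * A.indicator 1 z) + a * 1) ^ 2 * z ^ 2 +
      (a * (a * b / 2 * A.indicator 1 z) - b * 1) ^ 2 ≤ E z := fun z => by
    by_cases hz : z ∈ A
    · have hz2 : z ^ 2 ≤ 1 / 4 := by nlinarith [(hsub hz).1, (hsub hz).2]
      simpa [E, hz] using sq_mul_add_sq_le_of_sq_le hv hz2
    · simp [E, hz, ha, hb, Real.sq_sqrt hv.1.le, Real.sq_sqrt (sub_nonneg.2 hv.2)]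
  have hE0 : ∀ z, 0 ≤ E z := fun z => le_trans (by positivity) (hpointwise z)
  have hind : Integrable (A.indicator (1 : ℝ → ℝ)) γ := (integrable_const (1 : ℝ)).indicator hA
  have hsq : Integrable (fun z : ℝ => v * z ^ 2) γ := memLp_id_gaussian.integrable_sq.const_mul _
  have hquad : Integrable (fun z : ℝ => v * z ^ 2 + (1 - v)) γ := hsq.add (integrable_const _)
  have hE : Integrable E γ := hquad.sub (hind.const_mul _)
  have hEint : ∫ z, E z ∂γ = 1 - v * (1 - v) / 4 * Measure.real γ A := by
    rw [integral_sub hquad (hind.const_mul _), integral_add hsq (integrable_const _),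
      integral_const_mul, integral_const_mul, integral_sq_gaussian, integral_indicator_one hA]
    simp
  suffices mmseZ (A.indicator 1) v / v ≤ 1 - v * (1 - v) / 4 * Measure.real γ A by linarith
  refine mmseZ_div_le_of_residErr_le hf hv (h := fun p => -(a * b / 2) * p.1 * p.2) (by fun_prop)
    (hEint ▸ integral_nonneg hE0) ?_
  have herr : residErr (A.indicator 1) v (fun p => -(a * b / 2) * p.1 * p.2) =
      ∫⁻ z, ENNReal.ofReal ((b * (a * b / 2 * A.indicator 1 z) + a * 1) ^ 2 * z ^ 2 +
        (a * (a * b / 2 * A.indicator 1 z) - b * 1) ^ 2) ∂γ := by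
    rw [← meanSq_linear_combination (Ioc_subset_Icc_self hv)
      (F := fun z => a * b / 2 * A.indicator 1 z) (G := fun _ => 1) (by fun_prop) (by fun_prop)]
    exact lintegral_congr fun ω => by ring_nf
  rw [← hEint, ofReal_integral_eq_lintegral_ofReal hE (ae_of_all _ hE0), herr]
  exact lintegral_mono fun z => ENNReal.ofReal_le_ofReal (hpointwise z)

lemma one_le_meanSq_sub_add_setLIntegral (hA : MeasurableSet A) (hA2 : γ A ≤ 1 / 2) {g : ℝ → ℝ}
    {x : ℝ} (hg : ∀ w ∉ A, g w = x) :
    1 ≤ meanSq γ (fun w => w - g w) + 2 * ∫⁻ w in A, ENNReal.ofReal (w ^ 2) ∂γ := by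
  -- Compare `g` with the constant `x`, whose error is `1 + x²`; on `A` use `(w-x)² ≤ 2w² + 2x²`.
  have hcompl : ∫⁻ w in Aᶜ, ENNReal.ofReal ((x + -1 * w) ^ 2) ∂γ ≤ meanSq γ (fun w => w - g w) :=
    calc ∫⁻ w in Aᶜ, ENNReal.ofReal ((x + -1 * w) ^ 2) ∂γ
        = ∫⁻ w in Aᶜ, ENNReal.ofReal ((w - g w) ^ 2) ∂γ :=
          setLIntegral_congr_fun hA.compl fun w hw => by
            simp only [hg w hw]
            ring_nf
      _ ≤ meanSq γ (fun w => w - g w) := setLIntegral_le_lintegral _ _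
  have hsplit : ∫⁻ w in A, ENNReal.ofReal ((x + -1 * w) ^ 2) ∂γ ≤
      2 * ∫⁻ w in A, ENNReal.ofReal (w ^ 2) ∂γ + ENNReal.ofReal (x ^ 2) :=
    calc ∫⁻ w in A, ENNReal.ofReal ((x + -1 * w) ^ 2) ∂γ
        ≤ ∫⁻ w in A, 2 * ENNReal.ofReal (w ^ 2) + 2 * ENNReal.ofReal (x ^ 2) ∂γ := by
          refine lintegral_mono fun w => ?_
          rw [← ENNReal.ofReal_ofNat, ← ENNReal.ofReal_mul zero_le_two,
            ← ENNReal.ofReal_mul zero_le_two, ← ENNReal.ofReal_add (by positivity) (by positivity)]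
          exact ENNReal.ofReal_le_ofReal (by nlinarith [sq_nonneg (x + w)])
      _ = 2 * ∫⁻ w in A, ENNReal.ofReal (w ^ 2) ∂γ + 2 * ENNReal.ofReal (x ^ 2) * γ A := by
          rw [lintegral_add_right _ measurable_const, lintegral_const_mul _ (by fun_prop),
            setLIntegral_const]
      _ ≤ 2 * ∫⁻ w in A, ENNReal.ofReal (w ^ 2) ∂γ + 2 * ENNReal.ofReal (x ^ 2) * (1 / 2) := by
          gcongr
      _ = 2 * ∫⁻ w in A, ENNReal.ofReal (w ^ 2) ∂γ + ENNReal.ofReal (x ^ 2) := by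
          rw [mul_right_comm, one_div, ENNReal.mul_inv_cancel two_ne_zero ENNReal.ofNat_ne_top,
            one_mul]
  have htotal := meanSq_affine_gaussian x (-1)
  rw [meanSq, ← lintegral_add_compl _ hA, neg_one_sq, ENNReal.ofReal_add (sq_nonneg x) zero_le_one,
    ENNReal.ofReal_one] at htotal
  have hle := htotal.ge.trans (add_le_add hsplit hcompl)
  rw [add_right_comm, add_comm (_ + _) (ENNReal.ofReal _),
    ENNReal.add_le_add_iff_left ENNReal.ofReal_ne_top] at hle
  rwa [add_comm (meanSq _ _)]

/-- The noises `w` for which `Z = √(1-v) Y + √v w` lies in `A`, given `Y = y`. -/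
def cell (A : Set ℝ) (v y : ℝ) : Set ℝ := {w | √(1 - v) * y + √v * w ∈ A}

/-- The event, in terms of `(Y, W)`, that `1_A(Z)` takes the less likely of its two values given
`Y`. Off this event an estimator of `W` from `Y` and `1_A(Z)` depends on `Y` alone. -/
def surprise (A : Set ℝ) (v : ℝ) : Set (ℝ × ℝ) :=
  {ω | ω.2 ∈ cell A v ω.1 ↔ γ (cell A v ω.1) ≤ 1 / 2}

lemma measurableSet_cell (hA : MeasurableSet A) (v y : ℝ) : MeasurableSet (cell A v y) :=
  hA.preimage (by fun_prop : Measurable fun w => √(1 - v) * y + √v * w)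

lemma measurableSet_surprise (hA : MeasurableSet A) (v : ℝ) : MeasurableSet (surprise A v) := by
  have hcell : MeasurableSet {ω : ℝ × ℝ | ω.2 ∈ cell A v ω.1} :=
    hA.preimage (by fun_prop : Measurable fun ω : ℝ × ℝ => √(1 - v) * ω.1 + √v * ω.2)
  have hhalf : MeasurableSet {ω : ℝ × ℝ | γ (cell A v ω.1) ≤ 1 / 2} :=
    measurableSet_le ((measurable_measure_prodMk_left hcell).comp measurable_fst) measurable_const
  exact (hcell.mem.iff hhalf.mem).setOf

lemma one_le_meanSq_indicator_add (hA : MeasurableSet A) (v y : ℝ) (h : ℝ × ℝ → ℝ) :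
    1 ≤ meanSq γ (fun w => w - h (y, A.indicator 1 (√(1 - v) * y + √v * w))) +
      2 * ∫⁻ w in Prod.mk y ⁻¹' surprise A v, ENNReal.ofReal (w ^ 2) ∂γ := by
  have hcell := measurableSet_cell hA v y
  by_cases hy : γ (cell A v y) ≤ 1 / 2
  · have hpre : Prod.mk y ⁻¹' surprise A v = cell A v y := by
      ext w
      simp only [surprise, mem_preimage, mem_ofPred_eq, hy, iff_true]
    rw [hpre]
    refine one_le_meanSq_sub_add_setLIntegral hcell hy (x := h (y, 0)) fun w hw => ?_
    rw [indicator_of_notMem (show _ ∉ A from hw)]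
  · have hpre : Prod.mk y ⁻¹' surprise A v = (cell A v y)ᶜ := by
      ext w
      simp only [surprise, mem_preimage, mem_ofPred_eq, hy, iff_false, mem_compl_iff]
    have hcompl : γ (cell A v y)ᶜ ≤ 1 / 2 := by
      rw [prob_compl_eq_one_sub hcell, ← ENNReal.sub_half ENNReal.one_ne_top]
      exact tsub_le_tsub_left (not_le.1 hy).le 1
    rw [hpre]
    refine one_le_meanSq_sub_add_setLIntegral hcell.compl hcompl (x := h (y, 1)) fun w hw => ?_
    rw [indicator_of_mem (show _ ∈ A from not_not.1 hw), Pi.one_apply]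

lemma one_le_residErr_indicator_add (hA : MeasurableSet A) (v : ℝ) {h : ℝ × ℝ → ℝ}
    (hh : Measurable h) :
    1 ≤ residErr (A.indicator 1) v h +
      2 * ∫⁻ ω in surprise A v, ENNReal.ofReal (ω.2 ^ 2) ∂γ² := by
  have hS := measurableSet_surprise hA v
  have hsq : Measurable fun ω : ℝ × ℝ => ENNReal.ofReal (ω.2 ^ 2) := by fun_prop
  have herr : Measurable fun ω : ℝ × ℝ =>
    ENNReal.ofReal ((ω.2 - h (ω.1, A.indicator 1 (√(1 - v) * ω.1 + √v * ω.2))) ^ 2) := by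
    have : Measurable (A.indicator (1 : ℝ → ℝ)) := measurable_one.indicator hA
    fun_prop
  rw [residErr, meanSq, ← lintegral_indicator hS, lintegral_prod _ herr.aemeasurable,
    lintegral_prod _ (hsq.indicator hS).aemeasurable,
    ← lintegral_const_mul _ (hsq.indicator hS).lintegral_prod_right',
    ← lintegral_add_left herr.lintegral_prod_right']
  calc (1 : ℝ≥0∞) = ∫⁻ _, 1 ∂γ := by simp
    _ ≤ _ := lintegral_mono fun y => (one_le_meanSq_indicator_add hA v y h).trans_eq (by
        rw [← lintegral_indicator (measurable_prodMk_left hS)]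
        rfl)

lemma one_sub_mmseZ_div_indicator_le (hA : MeasurableSet A) (hv : v ∈ Ioc 0 1) :
    1 - mmseZ (A.indicator 1) v / v ≤
      (2 * ∫⁻ ω in surprise A v, ENNReal.ofReal (ω.2 ^ 2) ∂γ²).toReal := by
  refine one_sub_mmseZ_div_le_of_forall (measurable_one.indicator hA) hv ENNReal.toReal_nonneg
    fun h hh => ?_
  rw [ENNReal.ofReal_toReal (ENNReal.mul_ne_top ENNReal.ofNat_ne_top
    (ne_top_of_le_ne_top ENNReal.one_ne_top
      ((setLIntegral_le_lintegral _ _).trans_eq meanSq_snd_gaussian)))]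
  exact one_le_residErr_indicator_add hA v hh

lemma gaussian_cell_le (hA : A ⊆ Icc (-r) r) (hr : r ≤ 1 / 8) (hv : 1 / 4 ≤ v) (y : ℝ) :
    γ (cell A v y) ≤ 1 / 2 := by
  have ha : 1 / 2 ≤ √v := Real.le_sqrt_of_sq_le (by linarith)
  have hsub : cell A v y ⊆ Icc ((-r - √(1 - v) * y) / √v) ((r - √(1 - v) * y) / √v) :=
    fun w hw => ⟨(div_le_iff₀' (by linarith)).2 (by linarith [(hA hw).1]),
      (le_div_iff₀' (by linarith)).2 (by linarith [(hA hw).2])⟩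
  calc γ (cell A v y) ≤ volume (Icc ((-r - √(1 - v) * y) / √v) ((r - √(1 - v) * y) / √v)) :=
        (gaussian_le_volume _).trans (measure_mono hsub)
    _ = ENNReal.ofReal (2 * r / √v) := by
        rw [Real.volume_Icc]
        ring_nf
    _ ≤ ENNReal.ofReal (1 / 2) :=
        ENNReal.ofReal_le_ofReal ((div_le_iff₀ (by linarith)).2 (by linarith))
    _ = 1 / 2 := by
        rw [ENNReal.ofReal_div_of_pos two_pos, ENNReal.ofReal_one, ENNReal.ofReal_ofNat]

lemma one_sub_mmseZ_div_indicator_le_of_subset_Icc (hA : MeasurableSet A) (hsub : A ⊆ Icc (-r) r)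
    (hr : r ≤ 1 / 8) (hv : v ∈ Icc (1 / 4) 1) :
    1 - mmseZ (A.indicator 1) v / v ≤ 2 * ((r ^ 2 + (1 - v)) * Measure.real γ A) := by
  have hsurprise : surprise A v = {ω | √(1 - v) * ω.1 + √v * ω.2 ∈ A} := by
    ext ω
    exact iff_true_right (gaussian_cell_le hsub hr hv.1 ω.1)
  have hK : 0 ≤ r ^ 2 + (1 - v) := add_nonneg (sq_nonneg r) (sub_nonneg.2 hv.2)
  have hsecond : ∫⁻ ω in surprise A v, ENNReal.ofReal (ω.2 ^ 2) ∂γ² ≤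
      ENNReal.ofReal (r ^ 2 + (1 - v)) * γ A :=
    calc ∫⁻ ω in surprise A v, ENNReal.ofReal (ω.2 ^ 2) ∂γ²
        = meanSq γ² (fun ω => 0 * ω.1 + A.indicator 1 (√(1 - v) * ω.1 + √v * ω.2) * ω.2) := by
          rw [← lintegral_indicator (measurableSet_surprise hA v), hsurprise, meanSq]
          refine lintegral_congr fun ω => ?_
          by_cases hω : √(1 - v) * ω.1 + √v * ω.2 ∈ A <;> simp [hω]
      _ = ∫⁻ z, ENNReal.ofReal ((√(1 - v) * 0 + √v * A.indicator 1 z) ^ 2 * z ^ 2 +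
            (√v * 0 - √(1 - v) * A.indicator 1 z) ^ 2) ∂γ :=
          meanSq_linear_combination ⟨by linarith [hv.1], hv.2⟩ (F := fun _ => 0) measurable_const
            (measurable_one.indicator hA)
      _ ≤ ∫⁻ z, A.indicator (fun _ => ENNReal.ofReal (r ^ 2 + (1 - v))) z ∂γ := by
          refine lintegral_mono fun z => ?_
          by_cases hz : z ∈ A
          · have hz2 : z ^ 2 ≤ r ^ 2 := sq_le_sq' (hsub hz).1 (hsub hz).2
            have hv0 : 0 ≤ v := by linarith [hv.1]
            simp only [indicator_of_mem hz, Pi.one_apply, mul_one, mul_zero, zero_add, zero_sub,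
              neg_sq, Real.sq_sqrt hv0, Real.sq_sqrt (sub_nonneg.2 hv.2)]
            exact ENNReal.ofReal_le_ofReal (by nlinarith [hv.2, sq_nonneg z])
          · simp [hz]
      _ = ENNReal.ofReal (r ^ 2 + (1 - v)) * γ A := lintegral_indicator_const hA _
  refine (one_sub_mmseZ_div_indicator_le hA ⟨by linarith [hv.1], hv.2⟩).trans ?_
  rw [ENNReal.toReal_mul, ENNReal.toReal_ofNat]
  have := ENNReal.toReal_mono (by finiteness) hsecond
  rw [ENNReal.toReal_mul, ENNReal.toReal_ofReal hK, ← measureReal_def] at this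
  gcongr

lemma eventually_notMem_surprise (hA : MeasurableSet A) {ω : ℝ × ℝ} (hω : ω.1 ∉ frontier A) :
    ∀ᶠ v in 𝓝[>] 0, ω ∉ surprise A v := by
  have hpath : ∀ w, Tendsto (fun v => √(1 - v) * ω.1 + √v * w) (𝓝[>] 0) (𝓝 ω.1) := fun w => by
    have : Continuous fun v => √(1 - v) * ω.1 + √v * w := by fun_prop
    simpa using (this.tendsto 0).mono_left nhdsWithin_le_nhds
  by_cases hmem : ω.1 ∈ A
  · have hev : ∀ w, ∀ᶠ v in 𝓝[>] 0, w ∈ cell A v ω.1 := fun w =>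
      (hpath w).eventually (mem_interior_iff_mem_nhds.1
        (by_contra fun h => hω ⟨subset_closure hmem, h⟩))
    have hmeas : Tendsto (fun v => γ (cell A v ω.1)) (𝓝[>] 0) (𝓝 (γ univ)) :=
      tendsto_measure_of_ae_tendsto_indicator_of_isFiniteMeasure _ MeasurableSet.univ
        (measurableSet_cell hA · ω.1) (ae_of_all _ fun w => (hev w).mono fun v hv => by simpa)
    rw [measure_univ] at hmeas
    filter_upwards [hev ω.2, hmeas.eventually_const_lt ENNReal.one_half_lt_one] with v hv hhalf h
    exact hhalf.not_ge ((h.1 hv).trans_eq (one_div 2))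
  · have hev : ∀ w, ∀ᶠ v in 𝓝[>] 0, w ∉ cell A v ω.1 := fun w => by
      have hcl : ω.1 ∉ closure A := fun h => hω ⟨h, fun hint => hmem (interior_subset hint)⟩
      exact (hpath w).eventually (mem_of_superset (isClosed_closure.isOpen_compl.mem_nhds hcl)
        (compl_subset_compl.2 subset_closure))
    have hmeas : Tendsto (fun v => γ (cell A v ω.1)) (𝓝[>] 0) (𝓝 (γ ∅)) :=
      tendsto_measure_of_ae_tendsto_indicator_of_isFiniteMeasure _ MeasurableSet.empty
        (measurableSet_cell hA · ω.1) (ae_of_all _ fun w => (hev w).mono fun v hv => by simpa)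
    rw [measure_empty] at hmeas
    filter_upwards [hev ω.2, hmeas.eventually_lt_const (u := 1 / 2) (by simp)] with v hv hhalf h
    exact hv (h.2 hhalf.le)

lemma tendsto_mmseZ_div_indicator (hA : MeasurableSet A) (hfr : γ (frontier A) = 0) :
    Tendsto (fun v => mmseZ (A.indicator 1) v / v) (𝓝[>] 0) (𝓝 1) := by
  have hae : ∀ᵐ ω ∂γ², ω.1 ∉ frontier A :=
    Measure.quasiMeasurePreserving_fst.ae (measure_eq_zero_iff_ae_notMem.1 hfr)
  have hsurprise : Tendsto (fun v => ∫⁻ ω in surprise A v, ENNReal.ofReal (ω.2 ^ 2) ∂γ²)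
      (𝓝[>] 0) (𝓝 0) := by
    simp_rw [← lintegral_indicator (measurableSet_surprise hA _)]
    rw [← lintegral_zero (μ := γ²)]
    refine tendsto_lintegral_filter_of_dominated_convergence
      (fun ω => ENNReal.ofReal (ω.2 ^ 2))
      (Eventually.of_forall fun v => (by fun_prop : Measurable _).indicator
        (measurableSet_surprise hA v))
      (Eventually.of_forall fun v => ae_of_all _ fun ω => indicator_le_self _ _ ω)
      (meanSq_snd_gaussian.trans_ne ENNReal.one_ne_top) ?_
    filter_upwards [hae] with ω hω
    exact tendsto_const_nhds.congr' ((eventually_notMem_surprise hA hω).mono fun v hv =>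
      (indicator_of_notMem hv _).symm)
  have hbound : Tendsto (fun v =>
      1 - (2 * ∫⁻ ω in surprise A v, ENNReal.ofReal (ω.2 ^ 2) ∂γ²).toReal) (𝓝[>] 0) (𝓝 1) := by
    have htwice := ENNReal.Tendsto.const_mul (a := 2) hsurprise (Or.inr ENNReal.ofNat_ne_top)
    rw [mul_zero] at htwice
    simpa using ((ENNReal.tendsto_toReal ENNReal.zero_ne_top).comp htwice).const_sub 1
  have hpos : ∀ᶠ v in 𝓝[>] (0 : ℝ), v ∈ Ioc 0 1 := Ioc_mem_nhdsGT one_pos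
  refine tendsto_of_tendsto_of_tendsto_of_le_of_le' hbound tendsto_const_nhds ?_ ?_
  · filter_upwards [hpos] with v hv
    linarith [one_sub_mmseZ_div_indicator_le hA hv]
  · filter_upwards [hpos] with v hv
    exact div_le_one_of_le₀ (mmseZ_le_self (measurable_one.indicator hA) hv) hv.1.le

lemma mmseZ_pos_of_tendsto_div (hf : Measurable f)
    (hlim : Tendsto (fun v => mmseZ f v / v) (𝓝[>] 0) (𝓝 1)) (hv : v ∈ Ioc 0 1) :
    0 < mmseZ f v := by
  obtain ⟨u, hu, hu0, huv⟩ := ((hlim.eventually_const_lt zero_lt_one).and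
    (Ioc_mem_nhdsGT hv.1)).exists
  exact ((div_pos_iff_of_pos_right hu0).1 hu).trans_le
    (mmseZ_monotoneOn hf ⟨hu0, huv.trans hv.2⟩ hv huv)

end Indicator

/-! ### Two-point spectra and the indefinite comparison -/

section TwoPoint

variable {δ ε Λ x : ℝ}

/-- The law on `{ε, Λ}` with mean `δ`, for `ε < δ < Λ`. The spectra that are compared with the
constant spectrum have this form with `ε` close to `0`. -/
def twoPoint (δ ε Λ : ℝ) : Measure ℝ :=
  ENNReal.ofReal ((Λ - δ) / (Λ - ε)) • Measure.dirac ε +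
    ENNReal.ofReal ((δ - ε) / (Λ - ε)) • Measure.dirac Λ

lemma integral_twoPoint (hε : ε < δ) (hΛ : δ < Λ) (F : ℝ → ℝ) :
    ∫ l, F l ∂twoPoint δ ε Λ = (Λ - δ) / (Λ - ε) * F ε + (δ - ε) / (Λ - ε) * F Λ := by
  have hp : 0 ≤ (Λ - δ) / (Λ - ε) := div_nonneg (by linarith) (by linarith)
  have hq : 0 ≤ (δ - ε) / (Λ - ε) := div_nonneg (by linarith) (by linarith)
  rw [twoPoint, integral_add_measure
    ((integrable_dirac enorm_lt_top).smul_measure ENNReal.ofReal_ne_top)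
    ((integrable_dirac enorm_lt_top).smul_measure ENNReal.ofReal_ne_top),
    integral_smul_measure, integral_smul_measure, integral_dirac, integral_dirac,
    ENNReal.toReal_ofReal hp, ENNReal.toReal_ofReal hq, smul_eq_mul, smul_eq_mul]

lemma isLimitingSpectrum_twoPoint (hε0 : 0 < ε) (hε : ε < δ) (hΛ : δ < Λ) :
    IsLimitingSpectrum δ (twoPoint δ ε Λ) where
  prob := by
    have hsum : (Λ - δ) / (Λ - ε) + (δ - ε) / (Λ - ε) = 1 := by
      rw [← add_div, sub_add_sub_cancel, div_self (by linarith)]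
    refine ⟨?_⟩
    simp only [twoPoint, Measure.add_apply, Measure.smul_apply, measure_univ, smul_eq_mul, mul_one]
    rw [← ENNReal.ofReal_add (div_nonneg (by linarith) (by linarith))
      (div_nonneg (by linarith) (by linarith)), hsum, ENNReal.ofReal_one]
  support := by
    refine ⟨ε, Λ, hε0, ?_⟩
    have hle : ε ≤ Λ := by linarith
    simp [twoPoint, hle, Measure.dirac_apply' _ measurableSet_Icc.compl]
  mean := by
    rw [integral_twoPoint hε hΛ]
    have : Λ - ε ≠ 0 := by linarith
    field_simp
    ring

lemma abs_harm_twoPoint_sub_le (hε0 : 0 < ε) (hε : ε < δ) (hΛ : δ < Λ) (hx : 0 ≤ x) :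
    |harm (twoPoint δ ε Λ) x - δ / (1 + x * Λ)| ≤ ε := by
  have hΛ0 : 0 < 1 + x * Λ := by nlinarith
  have hgap : 0 < Λ - ε := by linarith
  have hp : 0 ≤ (Λ - δ) / (Λ - ε) := div_nonneg (by linarith) hgap.le
  have hp1 : (Λ - δ) / (Λ - ε) ≤ 1 := (div_le_one hgap).2 (by linarith)
  have hharm : harm (twoPoint δ ε Λ) x - δ / (1 + x * Λ) =
      (Λ - δ) / (Λ - ε) * (ε / (1 + x * ε)) - (Λ - δ) / (Λ - ε) * (ε / (1 + x * Λ)) := by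
    rw [harm, integral_twoPoint hε hΛ]
    field_simp
    ring
  have hε1 : ε / (1 + x * ε) ≤ ε := div_one_add_mul_le_self hx hε0.le
  have hε2 : ε / (1 + x * Λ) ≤ ε := div_le_self hε0.le (by nlinarith)
  rw [hharm, ← mul_sub, abs_mul, abs_of_nonneg hp]
  refine (mul_le_of_le_one_left (abs_nonneg _) hp1).trans
    (abs_sub_le_of_nonneg_of_le ?_ hε1 ?_ hε2) <;> positivity

lemma harm_dirac (δ x : ℝ) : harm (Measure.dirac δ) x = δ / (1 + x * δ) := integral_dirac _ _

lemma exists_isLimitingSpectrum_lt_mul_harm_lt {s t : ℝ} (hδ : 0 < δ) (hx : 0 < x) (hs : 0 ≤ s)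
    (hst : s < t) (ht : t ≤ δ * x / (1 + δ * x)) :
    ∃ P, IsLimitingSpectrum δ P ∧ s < x * harm P x ∧ x * harm P x < t := by
  -- `Λ` is chosen so that `x * (δ / (1 + x * Λ))` is the midpoint `T` of `s` and `t`.
  obtain ⟨T, hsT, hTt⟩ := exists_between hst
  have hT : 0 < T := hs.trans_lt hsT
  have hTδ : T * (1 + δ * x) < δ * x := (lt_div_iff₀ (by positivity)).1 (hTt.trans_le ht)
  set Λ := δ / T - x⁻¹ with hΛdef
  have hΛ : δ < Λ := by
    rw [hΛdef, lt_sub_iff_add_lt, lt_div_iff₀ hT]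
    field_simp
    linarith
  have hxΛ : x * (δ / (1 + x * Λ)) = T := by
    rw [hΛdef]
    field_simp
    ring_nf
  obtain ⟨ε, hε0, hε⟩ := exists_between
    (lt_min hδ (div_pos (lt_min (sub_pos.2 hsT) (sub_pos.2 hTt)) hx))
  obtain ⟨hεδ, hεx⟩ := lt_min_iff.1 hε
  obtain ⟨hεs, hεt⟩ := lt_min_iff.1 ((lt_div_iff₀' hx).1 hεx)
  obtain ⟨hlo, hhi⟩ := abs_le.1 (abs_harm_twoPoint_sub_le hε0 hεδ hΛ hx.le)
  refine ⟨twoPoint δ ε Λ, isLimitingSpectrum_twoPoint hε0 hεδ hΛ, ?_, ?_⟩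
  · nlinarith [mul_le_mul_of_nonneg_left hlo hx.le]
  · nlinarith [mul_le_mul_of_nonneg_left hhi hx.le]

end TwoPoint

section Indefinite

variable {f : ℝ → ℝ} {δ c u : ℝ}

lemma psi_one_pos (h0 : 0 < mmseZ f 1) (h1 : mmseZ f 1 < 1) : 0 < psi f 1 := by
  rw [psi, inv_one, sub_pos]
  exact (one_lt_inv₀ h0).2 h1

-- A law keeping `V⋆` at a small `v`, where almost no information is left, with error still above
-- the error of the constant spectrum at `1`.
theorem exists_mseStar_dirac_lt (hf : Measurable f) (hδ : 1 < δ)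
    (hlim : Tendsto (fun v => mmseZ f v / v) (𝓝[>] 0) (𝓝 1)) (h1 : mmseZ f 1 < 1) :
    ∃ P, IsLimitingSpectrum δ P ∧ mseStar f δ (Measure.dirac δ) < mseStar f δ P := by
  have hδ0 : 0 < δ := one_pos.trans hδ
  have hD := (isLimitingSpectrum_dirac hδ0).isPositiveLaw
  have hpos : ∀ {v}, v ∈ Ioc (0 : ℝ) 1 → 0 < mmseZ f v := mmseZ_pos_of_tendsto_div hf hlim
  have hone : (1 : ℝ) ∈ Ioc 0 1 := ⟨one_pos, le_rfl⟩
  have hx₁ := psi_one_pos (hpos hone) h1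
  set T := δ * psi f 1 / (1 + δ * psi f 1) with hT
  have hT0 : 0 < T := by positivity
  have hdirac : mseStar f δ (Measure.dirac δ) ≤ 1 - T := by
    refine (mseStar_le_mse_phi hf hD hδ (right_mem_Icc.2 zero_le_one) (by simp)).trans_eq ?_
    rw [mse_phi_eq hf hD hone (hpos hone), harm_dirac, hT]
    ring
  have hsmall : Tendsto (fun v => δ * (1 - mmseZ f v / v)) (𝓝[>] 0) (𝓝 0) := by
    simpa using (hlim.const_sub 1).const_mul δ
  obtain ⟨v, hvT, hv⟩ := ((hsmall.eventually_lt_const hT0).and (Ioc_mem_nhdsGT one_pos)).exists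
  have hψ := psi_mul_mmseZ hv.1.ne' (hpos hv).ne'
  have hxv : psi f 1 ≤ psi f v := psi_anti hf hv hone hv.2 (hpos hv)
  have hx : 0 < psi f v := hx₁.trans_le hxv
  have hTv : T ≤ δ * psi f v / (1 + δ * psi f v) := by
    rw [hT, div_le_div_iff₀ (by positivity) (by positivity)]
    nlinarith
  obtain ⟨P, hP, hlo, hhi⟩ := exists_isLimitingSpectrum_lt_mul_harm_lt hδ0 hx
    (mul_nonneg hδ0.le (hψ ▸ (mul_pos hx (hpos hv)).le)) hvT hTv
  have hP' := hP.isPositiveLaw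
  rw [← hψ, mul_left_comm] at hlo
  have hstep : v ≤ Phi δ P (phi f v) := le_of_not_gt fun hlt =>
    (lt_of_mul_lt_mul_left hlo hx.le).not_gt ((Phi_phi_lt_iff hf hP' hδ.le hv (hpos hv)).1 hlt)
  refine ⟨P, hP, hdirac.trans_lt (lt_of_lt_of_le ?_
    (mse_phi_le_mseStar hf hP' hδ.le (Ioc_subset_Icc_self hv) hstep))⟩
  rw [mse_phi_eq hf hP' hv (hpos hv)]
  linarith

lemma one_sub_le_mseStar_dirac (hf : Measurable f) (hδ : 1 < δ) (hu : u ∈ Ioc 0 1)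
    (hpos : 0 < mmseZ f u) (hinfo : δ * (1 - mmseZ f u / u) ≤ 1 - u) :
    1 - δ * psi f u ≤ mseStar f δ (Measure.dirac δ) := by
  have hδ0 : 0 < δ := one_pos.trans hδ
  have hD := (isLimitingSpectrum_dirac hδ0).isPositiveLaw
  have hx := psi_nonneg hf hu hpos
  have hψ := psi_mul_mmseZ hu.1.ne' hpos.ne'
  have hmu := mmseZ_le_self hf hu
  have hstep : u ≤ Phi δ (Measure.dirac δ) (phi f u) := by
    refine le_of_not_gt fun hlt => ((Phi_phi_lt_iff hf hD hδ.le hu hpos).1 hlt).not_ge ?_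
    rw [harm_dirac, le_div_iff₀ (by positivity), mul_assoc]
    refine mul_le_of_le_one_right hδ0.le ?_
    calc mmseZ f u * (1 + psi f u * δ) = mmseZ f u + δ * (1 - mmseZ f u / u) := by
          rw [← hψ]
          ring
      _ ≤ 1 := by linarith
  refine le_trans ?_ (mse_phi_le_mseStar hf hD hδ.le (Ioc_subset_Icc_self hu) hstep)
  rw [mse_phi_eq hf hD hu hpos, harm_dirac, mul_comm δ]
  gcongr
  exact div_le_self hδ0.le (by nlinarith)

lemma exists_forall_inv_add_lt_mmseZ (hf : Measurable f) (hδ : 1 ≤ δ) (hc : 0 < c)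
    (h0 : 0 < mmseZ f (1 / 2)) (h1 : mmseZ f 1 < 1)
    (hlow : ∀ v ∈ Icc (1 / 2 : ℝ) 1, (1 - v) * c ≤ psi f v) :
    ∃ η > 0, ∀ v ∈ Icc (1 / 2 : ℝ) 1, (1 + psi f v * (δ + 4 / c))⁻¹ + η < mmseZ f v := by
  have hhalf : (1 / 2 : ℝ) ∈ Ioc 0 1 := by norm_num
  have hone : (1 : ℝ) ∈ Ioc 0 1 := ⟨one_pos, le_rfl⟩
  have hm1 : 0 < mmseZ f 1 := h0.trans_le (mmseZ_monotoneOn hf hhalf hone hhalf.2)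
  set m₀ := mmseZ f (1 / 2)
  set κ := 2 * (psi f 1 / c)
  have hκ : 0 < κ := mul_pos two_pos (div_pos (psi_one_pos hm1 h1) hc)
  refine ⟨κ * m₀ ^ 2 / (1 + κ) / 2, by positivity, fun v hv => ?_⟩
  have hv' : v ∈ Ioc 0 1 := ⟨by linarith [hv.1], hv.2⟩
  have hmv : m₀ ≤ mmseZ f v := mmseZ_monotoneOn hf hhalf hv' hv.1
  set m := mmseZ f v
  have hmpos : 0 < m := h0.trans_le hmv
  have hm_le : m ≤ 1 := (mmseZ_le_self hf hv').trans hv.2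
  have hinv : m⁻¹ + κ ≤ 1 + psi f v * (δ + 4 / c) := by
    have hψ := psi_nonneg hf hv' hmpos
    have hψ₁ : psi f 1 / c ≤ psi f v / c := by
      gcongr
      exact psi_anti hf hv' hone hv.2 hmpos
    have hv_inv : v⁻¹ ≤ 1 + 2 * (1 - v) := by
      rw [inv_le_iff_one_le_mul₀ hv'.1]
      nlinarith [hv.1, hv.2]
    have hvc : 1 - v ≤ psi f v / c := (le_div_iff₀ hc).2 (hlow v hv)
    have hm_inv : m⁻¹ = psi f v + v⁻¹ := (sub_add_cancel _ _).symm
    have hexpand : psi f v * (δ + 4 / c) = psi f v * δ + 4 * (psi f v / c) := by ring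
    rw [hexpand, hm_inv]
    linarith [le_mul_of_one_le_right hψ hδ]
  have hgap : m - (m⁻¹ + κ)⁻¹ = κ * m ^ 2 / (1 + κ * m) := by
    field_simp
    ring
  have hgap_ge : κ * m₀ ^ 2 / (1 + κ) ≤ κ * m ^ 2 / (1 + κ * m) := by
    gcongr
    exact mul_le_of_le_one_right hκ.le hm_le
  have hη : 0 < κ * m₀ ^ 2 / (1 + κ) := by positivity
  linarith [inv_anti₀ (by positivity) hinv]

lemma mul_div_le_mul_div_one_add_mul {x : ℝ} (hδ : 0 ≤ δ) (hc : 0 < c) (hδc : δ * c ≤ 1)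
    (hcx : c ≤ 2 * x) : c * δ / 7 ≤ x * (δ / (1 + x * (δ + 4 / c))) := by
  have hx : 0 < x := by linarith
  have hmain : c * (1 + x * (δ + 4 / c)) ≤ x * 7 := by
    have hexpand : c * (1 + x * (δ + 4 / c)) = c + x * (δ * c + 4) := by
      field_simp
    rw [hexpand]
    linarith [mul_le_mul_of_nonneg_left hδc hx.le]
  rw [← mul_div_assoc, div_le_div_iff₀ (by norm_num) (by positivity)]
  linarith [mul_le_mul_of_nonneg_left hmain hδ]

-- `twoPoint δ ε (δ + 4 / c)` pushes `V⋆` below `1/2`; there the error stays away from `1`, the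
-- limit of the error of the constant spectrum as `psi f u` tends to `0`.
theorem exists_mseStar_lt_dirac (hf : Measurable f) (hδ : 1 < δ)
    (hpos : ∀ v ∈ Ioc (0 : ℝ) 1, 0 < mmseZ f v) (h1 : mmseZ f 1 < 1) (hc : 0 < c)
    (hδc : δ * c ≤ 1) (hlow : ∀ v ∈ Icc (1 / 2 : ℝ) 1, (1 - v) * c ≤ psi f v)
    (hu : u ∈ Ioc 0 1) (hinfo : δ * (1 - mmseZ f u / u) ≤ 1 - u) (hψu : psi f u < c / 14) :
    ∃ P, IsLimitingSpectrum δ P ∧ mseStar f δ P < mseStar f δ (Measure.dirac δ) := by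
  have hδ0 : 0 < δ := one_pos.trans hδ
  have hhalf : (1 / 2 : ℝ) ∈ Ioc 0 1 := by norm_num
  obtain ⟨η, hη0, hη⟩ := exists_forall_inv_add_lt_mmseZ hf hδ.le hc (hpos _ hhalf) h1 hlow
  set Λ := δ + 4 / c
  have hΛ : δ < Λ := lt_add_of_pos_right _ (by positivity)
  set x := psi f (1 / 2)
  have hcx : c ≤ 2 * x := by linarith [hlow (1 / 2) (by norm_num)]
  have hx : 0 < x := by linarith
  obtain ⟨ε, hε0, hε⟩ := exists_between
    (lt_min hδ0 (lt_min (mul_pos hδ0 hη0) (div_pos (by positivity : 0 < c * δ / 14) hx)))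
  obtain ⟨hεδ, hε'⟩ := lt_min_iff.1 hε
  obtain ⟨hεη, hεx⟩ := lt_min_iff.1 hε'
  rw [lt_div_iff₀' hx] at hεx
  have hP := isLimitingSpectrum_twoPoint hε0 hεδ hΛ
  have hdescent : ∀ w ∈ Ioc (1 / 2 : ℝ) 1, Phi δ (twoPoint δ ε Λ) (phi f w) < w := by
    intro w hw
    have hw' : w ∈ Ioc 0 1 := ⟨by linarith [hw.1], hw.2⟩
    have hψ := psi_nonneg hf hw' (hpos w hw')
    rw [Phi_phi_lt_iff hf hP.isPositiveLaw hδ.le hw' (hpos w hw')]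
    have hharm := (abs_le.1 (abs_harm_twoPoint_sub_le hε0 hεδ hΛ hψ)).2
    have hscaled := mul_lt_mul_of_pos_left (hη w (Ioc_subset_Icc_self hw)) hδ0
    rw [div_eq_mul_inv] at hharm
    linarith
  have hxharm : c * δ / 14 < x * harm (twoPoint δ ε Λ) x := by
    have hmain := mul_div_le_mul_div_one_add_mul hδ0.le hc hδc hcx
    have hharm := (abs_le.1 (abs_harm_twoPoint_sub_le hε0 hεδ hΛ hx.le)).1
    nlinarith [mul_le_mul_of_nonneg_left hharm hx.le]
  refine ⟨twoPoint δ ε Λ, hP, ?_⟩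
  calc mseStar f δ (twoPoint δ ε Λ) ≤ mse (twoPoint δ ε Λ) (phi f (1 / 2)) :=
        mseStar_le_mse_phi hf hP.isPositiveLaw hδ (Ioc_subset_Icc_self hhalf) hdescent
    _ = 1 - x * harm (twoPoint δ ε Λ) x := mse_phi_eq hf hP.isPositiveLaw hhalf (hpos _ hhalf)
    _ < 1 - δ * psi f u := by nlinarith
    _ ≤ mseStar f δ (Measure.dirac δ) := one_sub_le_mseStar_dirac hf hδ hu (hpos u hu) hinfo

lemma mul_le_psi_indicator {A : Set ℝ} {v : ℝ} (hA : MeasurableSet A)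
    (hsub : A ⊆ Icc (-(1 / 2)) (1 / 2)) (hv : v ∈ Ioc (0 : ℝ) 1)
    (hpos : 0 < mmseZ (A.indicator 1) v) :
    (1 - v) * (Measure.real γ A / 4) ≤ psi (A.indicator 1) v := by
  have hf : Measurable (A.indicator (1 : ℝ → ℝ)) := measurable_one.indicator hA
  refine le_of_mul_le_mul_left ?_ hv.1
  calc v * ((1 - v) * (Measure.real γ A / 4)) = v * (1 - v) / 4 * Measure.real γ A := by ring
    _ ≤ 1 - mmseZ (A.indicator 1) v / v := le_one_sub_mmseZ_div_indicator hA hsub hv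
    _ = mmseZ (A.indicator 1) v * psi (A.indicator 1) v := by
        rw [mul_comm, psi_mul_mmseZ hv.1.ne' hpos.ne']
    _ ≤ v * psi (A.indicator 1) v := by
        gcongr
        · exact psi_nonneg hf hv hpos
        · exact mmseZ_le_self hf hv

end Indefinite

section ShortInterval

variable {r : ℝ}

lemma real_gaussian_Icc_mem_Ioc (hr : 0 < r) : Measure.real γ (Icc 0 r) ∈ Ioc 0 r := by
  have := isOpenPosMeasure_gaussian
  refine ⟨ENNReal.toReal_pos ((isOpen_Ioo.measure_pos γ (nonempty_Ioo.2 hr)).trans_le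
    (measure_mono Ioo_subset_Icc_self)).ne' (measure_ne_top _ _), ?_⟩
  have := ENNReal.toReal_mono (by simp) (gaussian_le_volume (Icc 0 r))
  simpa [measureReal_def, hr.le] using this

lemma tendsto_mmseZ_div_indicator_Icc (hr : 0 ≤ r) :
    Tendsto (fun v => mmseZ ((Icc 0 r).indicator 1) v / v) (𝓝[>] 0) (𝓝 1) := by
  have : NullSingletonClass γ := nullSingletonClass_gaussianReal one_ne_zero
  refine tendsto_mmseZ_div_indicator measurableSet_Icc ?_
  rw [frontier_Icc hr]
  exact (Set.toFinite _).measure_zero _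

lemma mmseZ_indicator_Icc_one_lt_one (hr : 0 < r) : mmseZ ((Icc 0 r).indicator 1) 1 < 1 := by
  have hf2 : MemLp ((Icc 0 r).indicator (1 : ℝ → ℝ)) 2 γ :=
    memLp_indicator_const 2 measurableSet_Icc 1 (Or.inr (measure_ne_top _ _))
  refine mmseZ_one_lt_one (measurable_one.indicator measurableSet_Icc) hf2 (ne_of_gt ?_)
  refine (integral_pos_iff_support_of_nonneg (fun z => ?_)
    (memLp_id_gaussian.integrable_mul hf2)).2 ?_
  · by_cases hz : z ∈ Icc 0 r
    · simpa [hz] using hz.1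
    · simp [hz]
  · have := isOpenPosMeasure_gaussian
    refine (isOpen_Ioo.measure_pos γ (nonempty_Ioo.2 hr)).trans_le (measure_mono fun z hz => ?_)
    simpa [Ioo_subset_Icc_self hz] using hz.1.ne'

lemma one_sub_mmseZ_div_indicator_Icc_le (hr : 0 < r) (hr1 : r ≤ 1 / 1000) :
    1 - mmseZ ((Icc 0 r).indicator 1) (1 - r) / (1 - r) ≤
      3 * (r * Measure.real γ (Icc 0 r)) := by
  refine (one_sub_mmseZ_div_indicator_le_of_subset_Icc measurableSet_Icc
    (Icc_subset_Icc_left (by linarith)) (by linarith) ⟨by linarith, by linarith⟩).trans ?_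
  nlinarith [mul_pos hr (real_gaussian_Icc_mem_Ioc hr).1]

lemma psi_indicator_Icc_lt (hr : 0 < r) (hr1 : r ≤ 1 / 1000) :
    psi ((Icc 0 r).indicator 1) (1 - r) < Measure.real γ (Icc 0 r) / 4 / 14 := by
  obtain ⟨hp, hpr⟩ := real_gaussian_Icc_mem_Ioc hr
  have hinfo := one_sub_mmseZ_div_indicator_Icc_le hr hr1
  set p := Measure.real γ (Icc 0 r)
  have hrp : r * p ≤ 1 / 1000 * p := mul_le_mul_of_nonneg_right hr1 hp.le
  have hu : 0 < 1 - r := by linarith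
  have hm : 1 / 2 ≤ mmseZ ((Icc 0 r).indicator 1) (1 - r) := by
    have hratio : 3 / 4 ≤ mmseZ ((Icc 0 r).indicator 1) (1 - r) / (1 - r) := by linarith
    linarith [(le_div_iff₀ hu).1 hratio]
  have hm0 := one_half_pos.trans_le hm
  rw [← psi_mul_mmseZ hu.ne' hm0.ne', ← le_div_iff₀ hm0] at hinfo
  refine hinfo.trans_lt ((div_lt_iff₀ hm0).2 ?_)
  nlinarith

theorem exists_indefinite_comparison {δ : ℝ} (hδ : 1 < δ) :
    ∃ f, IsAdmissible f ∧
      (∃ P, IsLimitingSpectrum δ P ∧ mseStar f δ P < mseStar f δ (Measure.dirac δ)) ∧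
      (∃ P, IsLimitingSpectrum δ P ∧ mseStar f δ (Measure.dirac δ) < mseStar f δ P) := by
  have hδ0 : 0 < δ := one_pos.trans hδ
  -- Any `r` small compared with `1 / δ` would do.
  obtain ⟨r, hr, hδr⟩ : ∃ r > 0, δ * r = 1 / 1000 :=
    ⟨1 / 1000 / δ, by positivity, mul_div_cancel₀ _ hδ0.ne'⟩
  have hr1 : r ≤ 1 / 1000 := hδr ▸ le_mul_of_one_le_left hr.le hδ.le
  set f : ℝ → ℝ := (Icc 0 r).indicator 1
  have hf : Measurable f := measurable_one.indicator measurableSet_Icc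
  have hlim : Tendsto (fun v => mmseZ f v / v) (𝓝[>] 0) (𝓝 1) :=
    tendsto_mmseZ_div_indicator_Icc hr.le
  have hpos : ∀ v ∈ Ioc (0 : ℝ) 1, 0 < mmseZ f v := fun v => mmseZ_pos_of_tendsto_div hf hlim
  have h1 : mmseZ f 1 < 1 := mmseZ_indicator_Icc_one_lt_one hr
  obtain ⟨hp, hpr⟩ := real_gaussian_Icc_mem_Ioc hr
  have hinfo : δ * (1 - mmseZ f (1 - r) / (1 - r)) ≤ 1 - (1 - r) := by
    have := mul_le_mul_of_nonneg_left (one_sub_mmseZ_div_indicator_Icc_le hr hr1) hδ0.le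
    nlinarith
  have hlow : ∀ v ∈ Icc (1 / 2 : ℝ) 1, (1 - v) * (Measure.real γ (Icc 0 r) / 4) ≤ psi f v :=
    fun v hv => by
      have hv' : v ∈ Ioc 0 1 := ⟨one_half_pos.trans_le hv.1, hv.2⟩
      exact mul_le_psi_indicator measurableSet_Icc
        (Icc_subset_Icc (by norm_num) (by linarith)) hv' (hpos v hv')
  exact ⟨f, isAdmissible_indicator_Icc 0 r,
    exists_mseStar_lt_dirac hf hδ hpos h1 (by positivity) (by nlinarith) hlow
      ⟨by linarith, by linarith⟩ hinfo (psi_indicator_Icc_lt hr hr1),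
    exists_mseStar_dirac_lt hf hδ hlim h1⟩

end ShortInterval

theorem exists_isAdmissible_indefinite {δ : ℝ} (hδ : 1 < δ) :
    ∃ f : ℝ → ℝ, IsAdmissible f ∧
      ¬ MonotoneOn (GFun f δ) (Icc 0 1) ∧ ¬ AntitoneOn (GFun f δ) (Icc 0 1) ∧
      (∃ P₁ P₂ : Measure ℝ, IsLimitingSpectrum δ P₁ ∧ IsLimitingSpectrum δ P₂ ∧
        Spikier P₁ P₂ ∧ mseStar f δ P₁ < mseStar f δ P₂) ∧
      (∃ P₁ P₂ : Measure ℝ, IsLimitingSpectrum δ P₁ ∧ IsLimitingSpectrum δ P₂ ∧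
        Spikier P₁ P₂ ∧ mseStar f δ P₂ < mseStar f δ P₁) := by
  obtain ⟨f, hf, ⟨P, hP, hlt⟩, ⟨Q, hQ, hgt⟩⟩ := exists_indefinite_comparison hδ
  have hD := isLimitingSpectrum_dirac (one_pos.trans hδ)
  have hPD := hP.isPositiveLaw.spikier_dirac
  have hQD := hQ.isPositiveLaw.spikier_dirac
  refine ⟨f, hf, fun hG => ?_, fun hG => ?_, ⟨P, _, hP, hD, hPD, hlt⟩, ⟨Q, _, hQ, hD, hQD, hgt⟩⟩
  · exact hgt.not_ge (mseStar_le_of_GFun_monotoneOn hQD hf.measurable hQ.isPositiveLaw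
      hD.isPositiveLaw hδ hG)
  · exact hlt.not_ge (mseStar_le_of_GFun_antitoneOn hPD hf.measurable hP.isPositiveLaw
      hD.isPositiveLaw hδ hG)

end

end GLMEP

theorem mainTheorem4_general :
    (∀ (f : ℝ → ℝ) (δ : ℝ) (P₁ P₂ : Measure ℝ), Measurable f → 1 < δ →
      GLMEP.IsPositiveLaw δ P₁ → GLMEP.IsPositiveLaw δ P₂ → GLMEP.Spikier P₁ P₂ →
      Tendsto (GLMEP.seVr f δ P₁) atTop (𝓝 (GLMEP.Vstar f δ P₁)) ∧
      Tendsto (GLMEP.seVr f δ P₂) atTop (𝓝 (GLMEP.Vstar f δ P₂)) ∧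
      (MonotoneOn (GLMEP.GFun f δ) (Icc 0 1) →
        GLMEP.mseStar f δ P₁ ≤ GLMEP.mseStar f δ P₂) ∧
      (AntitoneOn (GLMEP.GFun f δ) (Icc 0 1) →
        GLMEP.mseStar f δ P₂ ≤ GLMEP.mseStar f δ P₁)) ∧
    (∀ δ : ℝ, 1 < δ → ∃ f : ℝ → ℝ, GLMEP.IsAdmissible f ∧
      ¬ MonotoneOn (GLMEP.GFun f δ) (Icc 0 1) ∧ ¬ AntitoneOn (GLMEP.GFun f δ) (Icc 0 1) ∧
      (∃ P₁ P₂ : Measure ℝ, GLMEP.IsLimitingSpectrum δ P₁ ∧ GLMEP.IsLimitingSpectrum δ P₂ ∧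
        GLMEP.Spikier P₁ P₂ ∧ GLMEP.mseStar f δ P₁ < GLMEP.mseStar f δ P₂) ∧
      (∃ P₁ P₂ : Measure ℝ, GLMEP.IsLimitingSpectrum δ P₁ ∧ GLMEP.IsLimitingSpectrum δ P₂ ∧
        GLMEP.Spikier P₁ P₂ ∧ GLMEP.mseStar f δ P₂ < GLMEP.mseStar f δ P₁)) :=
  ⟨fun _ _ _ _ hf hδ h₁ h₂ h => ⟨GLMEP.tendsto_seVr hf h₁ hδ.le, GLMEP.tendsto_seVr hf h₂ hδ.le,
    GLMEP.mseStar_le_of_GFun_monotoneOn h hf h₁ h₂ hδ,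
    GLMEP.mseStar_le_of_GFun_antitoneOn h hf h₁ h₂ hδ⟩,
    fun _ => GLMEP.exists_isAdmissible_indefinite⟩

theorem mainTheorem4 :
    (∀ (f : ℝ → ℝ) (δ : ℝ) (P₁ P₂ : Measure ℝ), GLMEP.IsAdmissible f → 1 < δ →
      GLMEP.IsLimitingSpectrum δ P₁ → GLMEP.IsLimitingSpectrum δ P₂ → GLMEP.Spikier P₁ P₂ →
      Tendsto (GLMEP.seVr f δ P₁) atTop (𝓝 (GLMEP.Vstar f δ P₁)) ∧
      Tendsto (GLMEP.seVr f δ P₂) atTop (𝓝 (GLMEP.Vstar f δ P₂)) ∧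
      (MonotoneOn (GLMEP.GFun f δ) (Icc 0 1) →
        GLMEP.mseStar f δ P₁ ≤ GLMEP.mseStar f δ P₂) ∧
      (AntitoneOn (GLMEP.GFun f δ) (Icc 0 1) →
        GLMEP.mseStar f δ P₂ ≤ GLMEP.mseStar f δ P₁)) ∧
    (∀ δ : ℝ, 1 < δ → ∃ f : ℝ → ℝ, GLMEP.IsAdmissible f ∧
      ¬ MonotoneOn (GLMEP.GFun f δ) (Icc 0 1) ∧ ¬ AntitoneOn (GLMEP.GFun f δ) (Icc 0 1) ∧
      (∃ P₁ P₂ : Measure ℝ, GLMEP.IsLimitingSpectrum δ P₁ ∧ GLMEP.IsLimitingSpectrum δ P₂ ∧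
        GLMEP.Spikier P₁ P₂ ∧ GLMEP.mseStar f δ P₁ < GLMEP.mseStar f δ P₂) ∧
      (∃ P₁ P₂ : Measure ℝ, GLMEP.IsLimitingSpectrum δ P₁ ∧ GLMEP.IsLimitingSpectrum δ P₂ ∧
        GLMEP.Spikier P₁ P₂ ∧ GLMEP.mseStar f δ P₂ < GLMEP.mseStar f δ P₁)) :=
  ⟨fun f δ P₁ P₂ hf hδ h₁ h₂ => mainTheorem4_general.1 f δ P₁ P₂ hf.measurable hδ
    h₁.isPositiveLaw h₂.isPositiveLaw, mainTheorem4_general.2⟩
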